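/- Let $F$ be a number field and let $S$ be a finite set of nonzero primes of $\mathcal{O}_F$. For $\mathfrak{p}\in S$ let $F_\mathfrak{p}$ be the completion of $F$ at $\mathfrak{p}$, with ring of integers $\mathcal{O}_{F,\mathfrak{p}}$ and maximal ideal again denoted $\mathfrak{p}$. Let $\mathscr{V}_\mathfrak{p}$ be the set of homothety classes of $\mathcal{O}_{F,\mathfrak{p}}$-lattices in $F_\mathfrak{p}^2$, and let $\mathscr{E}_\mathfrak{p}$ be the set of oriented edges $e=(s(e),t(e))$, i.e. pairs of vertices having representatives $\Lambda_s,\Lambda_t$ with $\mathfrak{p}\Lambda_t\subsetneq\Lambda_s\subsetneq\Lambda_t$; write $\overline{e}=(t(e),s(e))$. Put $\mathscr{E}_S=\prod_{\mathfrak{p}\in S}\mathscr{E}_\mathfrak{p}$ (multiedges), $\mathbb{P}^1(F_S)=\prod_{\mathfrak{p}\in S}\mathbb{P}^1(F_\mathfrak{p})$ with the product topology, and $\mathrm{PGL}_2(F_S)=\prod_{\mathfrak{p}\in S}\mathrm{PGL}_2(F_\mathfrak{p})$. For $e\in\mathscr{E}_S$ let $\overline{e}^{\mathfrak{p}}$ be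 $e$ with its $\mathfrak{p}$-component $e_\mathfrak{p}$ replaced by $\overline{e_\mathfrak{p}}$. The group $\mathrm{HC}_S(\mathbb{Z})$ of integral $S$-harmonic cochains consists of the functions $c\colon\mathscr{E}_S\to\mathbb{Z}$ such that, for every $\mathfrak{p}\in S$, $c(e)+c(\overline{e}^{\mathfrak{p}})=0$ for all $e\in\mathscr{E}_S$, and $\sum_{s(e')=v}c(e',e^{\mathfrak{p}})=0$ for all $v\in\mathscr{V}_\mathfrak{p}$ and all $e^{\mathfrak{p}}\in\prod_{\mathfrak{q}\neq\mathfrak{p}}\mathscr{E}_\mathfrak{q}$, the sum being over $e'\in\mathscr{E}_\mathfrak{p}$ with source $v$. Let $\mathscr{M}(\mathbb{P}^1(F_S),\mathbb{Z})$ be the group of finitely additive $\mathbb{Z}$-valued functions $\mu$ on the compact open subsets of $\mathbb{P}^1(F_S)$ such that $\mu(\mathbb{P}^1(F_\mathfrak{p})\times V)=0$ for every $\mathfrak{p}\in S$ and every compact open $V\subseteq\prod_{\mathfrak{q}\in S,\,\mathfrak{q}\neq\mathfrak{p}}\mathbb{P}^1(F_\mathfrak{q})$. The group $\mathrm{PGL}_2(F_S)$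 acts on these two groups by $(g\star c)(e)=c(g^{-1}e)$ and $(g\star\mu)(U)=\mu(g^{-1}U)$. For $e\in\mathscr{E}_S$ choose for each $\mathfrak{p}$ lattices $\Lambda_s,\Lambda_t$ representing the source and target of $e_\mathfrak{p}$ with $\mathfrak{p}\Lambda_t\subsetneq\Lambda_s\subsetneq\Lambda_t$, let $U_{e_\mathfrak{p}}\subseteq\mathbb{P}^1(F_\mathfrak{p})$ be the image of $(\Lambda_s\setminus\mathfrak{p}\Lambda_s)\cap(\Lambda_t\setminus\mathfrak{p}\Lambda_t)$ (which is independent of the choice), and let $U_e=\prod_{\mathfrak{p}\in S}U_{e_\mathfrak{p}}$. Then every $U_e$ is compact and open in $\mathbb{P}^1(F_S)$, and there is a $\mathrm{PGL}_2(F_S)$-equivariant isomorphism of groups $$\mathrm{HC}_S(\mathbb{Z})\overset{\sim}{\longrightarrow}\mathscr{M}(\mathbb{P}^1(F_S),\mathbb{Z}),\qquad c\mapsto\mu_c,$$ where $\mu_c$ is characterized by $\mu_c(U_e)=c(e)$ for every multiedge $e\in\mathscr{E}_S$; that is, $\mu_c$ has these values, and it is the only finitely additive $\mathbb{Z}$-valued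 function on the compact open subsets of $\mathbb{P}^1(F_S)$ that has them. -/

import Mathlib

open scoped MatrixGroups Pointwise LinearAlgebra.Projectivization
open NumberField IsDedekindDomain

namespace Plectic

/-! ### The Bruhat–Tits tree of `PGL₂` over a discretely valued field

`K` is a field and `A` is its valuation ring, with maximal ideal `𝔭`. -/

section Tree

variable {K : Type*} [Field K]

/-- An `A`-lattice in `K ⊕ K`: a finitely generated `A`-submodule that spans `K ⊕ K` over `K`. -/
structure Lat (A : ValuationSubring K) where
  toSubmodule : Submodule A (Fin 2 → K)
  isLattice : Submodule.IsLattice K toSubmodule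

variable {A : ValuationSubring K}

namespace Lat

theorem ext' {Λ Λ' : Lat A} (h : Λ.toSubmodule = Λ'.toSubmodule) : Λ = Λ' := by
  cases Λ; cases Λ'; cases h; rfl

/-- The scalar multiple `a Λ`. -/
instance : MulAction Kˣ (Lat A) where
  smul a Λ := ⟨a • Λ.toSubmodule, haveI := Λ.isLattice; inferInstance⟩
  one_smul _ := ext' (one_smul _ _)
  mul_smul _ _ _ := ext' (mul_smul _ _ _)

theorem smul_toSubmodule (a : Kˣ) (Λ : Lat A) : (a • Λ).toSubmodule = a • Λ.toSubmodule := rfl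

theorem isLattice_gl_smul (g : GL (Fin 2) K) (M : Submodule A (Fin 2 → K))
    (h : Submodule.IsLattice K M) : Submodule.IsLattice K (g • M) where
  fg := h.fg.map _
  span_eq_top := by
    have h1 : ((g • M : Submodule A (Fin 2 → K)) : Set (Fin 2 → K)) = g • (M : Set (Fin 2 → K)) :=
      rfl
    rw [h1, ← Submodule.smul_span, h.span_eq_top]
    refine eq_top_iff.2 fun x _ => ?_
    have := Submodule.smul_mem_pointwise_smul (g⁻¹ • x) g (⊤ : Submodule K (Fin 2 → K)) trivial
    rwa [smul_inv_smul] at this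

/-- The image `g Λ` of a lattice (of column vectors) under an invertible matrix. -/
instance : MulAction (GL (Fin 2) K) (Lat A) where
  smul g Λ := ⟨g • Λ.toSubmodule, isLattice_gl_smul g _ Λ.isLattice⟩
  one_smul _ := ext' (one_smul _ _)
  mul_smul _ _ _ := ext' (mul_smul _ _ _)

theorem gl_smul_toSubmodule (g : GL (Fin 2) K) (Λ : Lat A) :
    (g • Λ).toSubmodule = g • Λ.toSubmodule := rfl

instance : SMulCommClass (GL (Fin 2) K) Kˣ (Lat A) where
  smul_comm g a Λ := ext' <| SetLike.coe_injective <|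
    smul_comm g a (Λ.toSubmodule : Set (Fin 2 → K))

/-- The submodule `𝔭 Λ` of `Λ`. -/
def pMul (Λ : Lat A) : Submodule A (Fin 2 → K) :=
  IsLocalRing.maximalIdeal A • Λ.toSubmodule

/-- The set `Λ' = Λ ∖ 𝔭 Λ` of primitive vectors of `Λ`. -/
def primitive (Λ : Lat A) : Set (Fin 2 → K) :=
  {v | v ∈ Λ.toSubmodule ∧ v ∉ Λ.pMul}

/-- The relation `𝔭 Λ₂ ⊊ Λ₁ ⊊ Λ₂`. -/
def Adj (Λ₁ Λ₂ : Lat A) : Prop :=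
  Λ₂.pMul < Λ₁.toSubmodule ∧ Λ₁.toSubmodule < Λ₂.toSubmodule

theorem pMul_gl_smul (g : GL (Fin 2) K) (Λ : Lat A) : (g • Λ).pMul = g • Λ.pMul :=
  (Submodule.map_smul'' _ _ _).symm

theorem pMul_smul (a : Kˣ) (Λ : Lat A) : (a • Λ).pMul = a • Λ.pMul :=
  (Submodule.map_smul'' _ _ _).symm

theorem gl_smul_lt (g : GL (Fin 2) K) {M N : Submodule A (Fin 2 → K)} (h : M < N) :
    g • M < g • N := by
  rw [← SetLike.coe_ssubset_coe] at h ⊢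
  exact (MulAction.injective g).image_strictMono h

theorem smul_lt (a : Kˣ) {M N : Submodule A (Fin 2 → K)} (h : M < N) :
    a • M < a • N := by
  rw [← SetLike.coe_ssubset_coe] at h ⊢
  exact (MulAction.injective a).image_strictMono h

theorem Adj.gl_smul {Λ₁ Λ₂ : Lat A} (h : Adj Λ₁ Λ₂) (g : GL (Fin 2) K) :
    Adj (g • Λ₁) (g • Λ₂) :=
  ⟨by rw [pMul_gl_smul]; exact gl_smul_lt g h.1, gl_smul_lt g h.2⟩

theorem Adj.smul {Λ₁ Λ₂ : Lat A} (h : Adj Λ₁ Λ₂) (a : Kˣ) : Adj (a • Λ₁) (a • Λ₂) :=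
  ⟨by rw [pMul_smul]; exact smul_lt a h.1, smul_lt a h.2⟩

/-- If `𝔭` is generated by `ϖ` then `𝔭 Λ = ϖ Λ`. -/
theorem exists_pMul_eq_smul [IsDiscreteValuationRing A] :
    ∃ a : Kˣ, ∀ Λ : Lat A, Λ.pMul = a • Λ.toSubmodule := by
  obtain ⟨ϖ, hϖ⟩ := IsDiscreteValuationRing.exists_irreducible A
  have h0 : (ϖ : K) ≠ 0 := fun h => hϖ.ne_zero (Subtype.ext h)
  refine ⟨Units.mk0 (ϖ : K) h0, fun Λ => ?_⟩
  unfold pMul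
  rw [hϖ.maximalIdeal_eq, Submodule.ideal_span_singleton_smul]
  rfl

theorem Adj.symm' [IsDiscreteValuationRing A] :
    ∃ a : Kˣ, ∀ Λ₁ Λ₂ : Lat A, Adj Λ₁ Λ₂ → Adj (a • Λ₂) Λ₁ := by
  obtain ⟨a, ha⟩ := exists_pMul_eq_smul (A := A)
  refine ⟨a, fun Λ₁ Λ₂ h => ⟨?_, ?_⟩⟩
  · rw [ha]; exact smul_lt a h.2
  · rw [smul_toSubmodule, ← ha]; exact h.1

end Lat

variable (A) in
/-- The vertices of the tree: homothety classes of lattices. -/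
abbrev Vertex : Type _ := MulAction.orbitRel.Quotient Kˣ (Lat A)

/-- The vertex given by the homothety class of a lattice. -/
def Vertex.mk (Λ : Lat A) : Vertex A := Quotient.mk'' Λ

theorem Vertex.mk_smul (a : Kˣ) (Λ : Lat A) : Vertex.mk (a • Λ) = Vertex.mk Λ :=
  Quotient.sound' ⟨a, rfl⟩

instance Vertex.glAction : MulAction (GL (Fin 2) K) (Vertex A) where
  smul g := Quotient.map' (fun Λ => g • Λ) <| by
    rintro _ Λ ⟨a, rfl⟩
    exact ⟨a, (smul_comm g a Λ).symm⟩
  one_smul := by rintro ⟨Λ⟩; exact congrArg Vertex.mk (one_smul _ Λ)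
  mul_smul g h := by rintro ⟨Λ⟩; exact congrArg Vertex.mk (mul_smul g h Λ)

theorem Vertex.gl_smul_mk (g : GL (Fin 2) K) (Λ : Lat A) :
    g • Vertex.mk Λ = Vertex.mk (g • Λ) := rfl

theorem Vertex.scalar_smul (u : Kˣ) (v : Vertex A) :
    Matrix.GeneralLinearGroup.scalar (Fin 2) u • v = v := by
  obtain ⟨Λ⟩ := v
  have : Matrix.GeneralLinearGroup.scalar (Fin 2) u • Λ = u • Λ := by
    refine Lat.ext' (SetLike.coe_injective ?_)
    refine Set.image_congr fun x _ => ?_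
    simp
  exact (congrArg Vertex.mk this).trans (Vertex.mk_smul u Λ)

/-- The left action of `PGL₂(K)` on vertices, induced by that of `GL₂(K)` on lattices. -/
instance Vertex.pglAction : MulAction PGL(2, K) (Vertex A) :=
  Matrix.ProjGenLinGroup.mulActionOfGL Vertex.scalar_smul

variable (A) in
/-- The oriented edges of the tree: pairs of vertices (source, target) which have representatives
`Λ₁`, `Λ₂` with `𝔭 Λ₂ ⊊ Λ₁ ⊊ Λ₂`. -/
@[ext]
structure Edge where
  src : Vertex A
  tgt : Vertex A
  adj : ∃ Λ₁ Λ₂ : Lat A, Vertex.mk Λ₁ = src ∧ Vertex.mk Λ₂ = tgt ∧ Λ₁.Adj Λ₂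

namespace Edge

/-- The opposite edge. -/
def opp [IsDiscreteValuationRing A] (e : Edge A) : Edge A where
  src := e.tgt
  tgt := e.src
  adj := by
    obtain ⟨Λ₁, Λ₂, h₁, h₂, h⟩ := e.adj
    obtain ⟨a, ha⟩ := Lat.Adj.symm' (A := A)
    exact ⟨a • Λ₂, Λ₁, (Vertex.mk_smul a Λ₂).trans h₂, h₁, ha Λ₁ Λ₂ h⟩

theorem adj_smul (g : PGL(2, K)) (e : Edge A) : ∃ Λ₁ Λ₂ : Lat A,
    Vertex.mk Λ₁ = g • e.src ∧ Vertex.mk Λ₂ = g • e.tgt ∧ Λ₁.Adj Λ₂ := by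
  obtain ⟨Λ₁, Λ₂, h₁, h₂, h⟩ := e.adj
  induction g using Matrix.ProjGenLinGroup.induction_on with
  | mk g => exact ⟨g • Λ₁, g • Λ₂, by rw [← h₁]; rfl, by rw [← h₂]; rfl, h.gl_smul g⟩

/-- The left action of `PGL₂(K)` on oriented edges. -/
instance : MulAction PGL(2, K) (Edge A) where
  smul g e := ⟨g • e.src, g • e.tgt, adj_smul g e⟩
  one_smul e := Edge.ext (one_smul _ e.src) (one_smul _ e.tgt)
  mul_smul g h e := Edge.ext (mul_smul g h e.src) (mul_smul g h e.tgt)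

theorem smul_src (g : PGL(2, K)) (e : Edge A) : (g • e).src = g • e.src := rfl

theorem smul_opp [IsDiscreteValuationRing A] (g : PGL(2, K)) (e : Edge A) :
    g • e.opp = (g • e).opp := rfl

/-- The subset `U_e = pr(Λ_s' ∩ Λ_t')` of `ℙ¹(K)`, where `Λ_s`, `Λ_t` are lattices representing the
source and the target of `e` with `𝔭 Λ_t ⊊ Λ_s ⊊ Λ_t`. All choices of `(Λ_s, Λ_t)` give the same
set (see `ends_eq`), so the definition takes the union over all of them. -/
def ends (e : Edge A) : Set (ℙ K (Fin 2 → K)) :=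
  {x | ∃ Λs Λt : Lat A, Vertex.mk Λs = e.src ∧ Vertex.mk Λt = e.tgt ∧ Λs.Adj Λt ∧
    ∃ (v : Fin 2 → K) (hv : v ≠ 0),
      v ∈ Λs.primitive ∩ Λt.primitive ∧ x = Projectivization.mk K v hv}


theorem mem_primitive_smul (b : Kˣ) (Λ : Lat A) (v : Fin 2 → K) :
    b • v ∈ (b • Λ).primitive ↔ v ∈ Λ.primitive := by
  unfold Lat.primitive
  rw [Lat.pMul_smul, Lat.smul_toSubmodule]
  exact and_congr
    (show b • v ∈ b • (Λ.toSubmodule : Set (Fin 2 → K)) ↔ _ from Set.smul_mem_smul_set_iff)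
    (not_congr
      (show b • v ∈ b • (Λ.pMul : Set (Fin 2 → K)) ↔ _ from Set.smul_mem_smul_set_iff))

/-- If `Λ_s` and `cΛ_s` both lie strictly between `𝔭 Λ_t` and `Λ_t`, they are equal. -/
theorem smul_eq_of_adj {Λs Λt : Lat A} (c : Kˣ) (h : Λs.Adj Λt) (h' : (c • Λs).Adj Λt) :
    c • Λs = Λs := by
  have key : ∀ (c : Kˣ) (M N : Lat A), (c : K) ∈ A → M.Adj N → (c • M).Adj N →
      (c • M).toSubmodule ≤ M.toSubmodule := by
    rintro c M N hc - - x ⟨y, hy, rfl⟩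
    exact M.toSubmodule.smul_mem ⟨c, hc⟩ hy
  have key2 : ∀ (c : Kˣ) (M N : Lat A) (hc : (c : K) ∈ A),
      (⟨c, hc⟩ : A) ∈ IsLocalRing.maximalIdeal A → M.Adj N → (c • M).Adj N → False := by
    intro c M N hc hm h h'
    refine h'.1.not_ge ?_
    rintro x ⟨y, hy, rfl⟩
    exact Submodule.smul_mem_smul hm (h.2.le hy)
  have hinv : c⁻¹ • c • Λs = Λs := inv_smul_smul c Λs
  by_cases hc : (c : K) ∈ A <;> by_cases hd : ((c⁻¹ : Kˣ) : K) ∈ A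
  · refine Lat.ext' (le_antisymm (key c Λs Λt hc h h') ?_)
    have := key c⁻¹ (c • Λs) Λt hd h' (by rwa [hinv])
    rw [hinv] at this
    intro x hx
    have h2 := this hx
    exact h2
  · refine (key2 c Λs Λt hc ?_ h h').elim
    rw [IsLocalRing.mem_maximalIdeal, mem_nonunits_iff]
    rintro hu
    obtain ⟨d, hd'⟩ := hu.exists_right_inv
    refine hd ?_
    have : ((c⁻¹ : Kˣ) : K) = d := by
      have h3 : (c : K) * d = 1 := congrArg Subtype.val hd'
      rw [Units.val_inv_eq_inv_val]
      exact (eq_inv_of_mul_eq_one_right h3).symm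
    rw [this]; exact d.2
  · refine (key2 c⁻¹ (c • Λs) Λt hd ?_ h' (by rwa [hinv])).elim
    rw [IsLocalRing.mem_maximalIdeal, mem_nonunits_iff]
    rintro hu
    obtain ⟨d, hd'⟩ := hu.exists_right_inv
    refine hc ?_
    have : (c : K) = d := by
      have h3 : ((c⁻¹ : Kˣ) : K) * d = 1 := congrArg Subtype.val hd'
      rw [Units.val_inv_eq_inv_val] at h3
      have := eq_inv_of_mul_eq_one_right h3
      rw [inv_inv] at this
      exact this.symm
    rw [this]; exact d.2
  · rcases A.mem_or_inv_mem (c : K) with h1 | h1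
    · exact (hc h1).elim
    · exact (hd (by rwa [Units.val_inv_eq_inv_val])).elim

/-- `U_e` does not depend on the choice of the lattices representing `e`. -/
theorem ends_eq (e : Edge A) {Λs Λt : Lat A} (hs : Vertex.mk Λs = e.src)
    (ht : Vertex.mk Λt = e.tgt) (h : Λs.Adj Λt) :
    e.ends = {x | ∃ (v : Fin 2 → K) (hv : v ≠ 0),
      v ∈ Λs.primitive ∩ Λt.primitive ∧ x = Projectivization.mk K v hv} := by
  ext x
  constructor
  · rintro ⟨Ms, Mt, hMs, hMt, hM, v, hv, ⟨hvs, hvt⟩, rfl⟩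
    obtain ⟨a, ha⟩ := Quotient.exact' (hMs.trans hs.symm)
    obtain ⟨b, hb⟩ := Quotient.exact' (hMt.trans ht.symm)
    change a • Λs = Ms at ha
    change b • Λt = Mt at hb
    subst ha hb
    have h1 : ((b⁻¹ * a) • Λs).Adj Λt := by
      have := hM.smul b⁻¹
      rwa [inv_smul_smul, smul_smul] at this
    have h2 := smul_eq_of_adj _ h h1
    refine ⟨b⁻¹ • v, (smul_ne_zero_iff_ne _).2 hv, ⟨?_, ?_⟩, ?_⟩
    · rw [← h2, mul_smul, mem_primitive_smul]; exact hvs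
    · have := (mem_primitive_smul b⁻¹ (b • Λt) v).2 hvt
      rwa [inv_smul_smul] at this
    · rw [Projectivization.mk_eq_mk_iff]
      exact ⟨b, smul_inv_smul b v⟩
  · rintro ⟨v, hv, hm, rfl⟩
    exact ⟨Λs, Λt, hs, ht, h, v, hv, hm, rfl⟩

/-- The tree is locally finite when the residue field is finite. -/
instance finite_star [IsDiscreteValuationRing A] [Finite (IsLocalRing.ResidueField A)]
    (v : Vertex A) : Finite {e : Edge A // e.src = v} := by
  obtain ⟨Λ⟩ := v
  have : Finite (A ⧸ IsLocalRing.maximalIdeal A) :=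
    inferInstanceAs (Finite (IsLocalRing.ResidueField A))
  have : Module.Finite A Λ.toSubmodule := Module.Finite.iff_fg.2 Λ.isLattice.fg
  let N : Submodule A Λ.toSubmodule := IsLocalRing.maximalIdeal A • (⊤ : Submodule A Λ.toSubmodule)
  have hN : N.map Λ.toSubmodule.subtype = Λ.pMul := by
    rw [Submodule.map_smul'', Submodule.map_top, Submodule.range_subtype]; rfl
  have : Finite (Λ.toSubmodule ⧸ N) :=
    Submodule.finite_quotient_smul _ (Module.Finite.fg_top (R := A) (M := Λ.toSubmodule))
  let T : Set (Lat A) := {L | Λ.pMul ≤ L.toSubmodule ∧ L.toSubmodule ≤ Λ.toSubmodule}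
  let f : Lat A → Set (Λ.toSubmodule ⧸ N) :=
    fun L => N.mkQ '' {x | (x : Fin 2 → K) ∈ L.toSubmodule}
  have hle : ∀ L ∈ T, ∀ L' ∈ T, f L = f L' → L.toSubmodule ≤ L'.toSubmodule := by
    intro L hL L' hL' h x hx
    have h1 : N.mkQ ⟨x, hL.2 hx⟩ ∈ f L := ⟨_, hx, rfl⟩
    rw [h] at h1
    obtain ⟨y, hy, hxy⟩ := h1
    have h2 : (⟨x, hL.2 hx⟩ : Λ.toSubmodule) - y ∈ N := (Submodule.Quotient.eq N).1 hxy.symm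
    have h3 : x - y ∈ Λ.pMul := hN ▸ Submodule.mem_map_of_mem (f := Λ.toSubmodule.subtype) h2
    have h4 := L'.toSubmodule.add_mem (hL'.1 h3) hy
    rwa [sub_add_cancel] at h4
  have hT : T.Finite := Set.Finite.of_finite_image (Set.toFinite (f '' T)) fun L hL L' hL' h =>
    Lat.ext' (le_antisymm (hle L hL L' hL' h) (hle L' hL' L hL h.symm))
  have hT' := hT.image Vertex.mk
  have : Finite (Vertex.mk '' T) := hT'
  refine Finite.of_injective (β := ↥(Vertex.mk '' T)) (fun e => ⟨e.1.tgt, ?_⟩) ?_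
  · obtain ⟨e, he⟩ := e
    obtain ⟨Λ₁, Λ₂, h₁, h₂, h⟩ := e.opp.adj
    obtain ⟨a, ha⟩ := Quotient.exact' (h₂.trans he)
    change a • Λ = Λ₂ at ha
    have h3 := h.smul a⁻¹
    rw [← ha, inv_smul_smul] at h3
    exact ⟨a⁻¹ • Λ₁, ⟨h3.1.le, h3.2.le⟩, (Vertex.mk_smul _ _).trans h₁⟩
  · rintro ⟨e, he⟩ ⟨e', he'⟩ h
    exact Subtype.ext (Edge.ext (he.trans he'.symm) (congrArg Subtype.val h))

end Edge

/-- The topology of the projective line: the quotient topology from `K² ∖ {0}`. -/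
instance projTopology [TopologicalSpace K] : TopologicalSpace (ℙ K (Fin 2 → K)) :=
  TopologicalSpace.coinduced (fun v : {v : Fin 2 → K // v ≠ 0} => Projectivization.mk K v.1 v.2)
    inferInstance

instance projContinuousConstSMul [TopologicalSpace K] [IsTopologicalRing K] :
    ContinuousConstSMul PGL(2, K) (ℙ K (Fin 2 → K)) where
  continuous_const_smul g := by
    induction g using Matrix.ProjGenLinGroup.induction_on with
    | mk g =>
      rw [continuous_coinduced_dom]
      have h1 : Continuous fun v : {v : Fin 2 → K // v ≠ 0} => Projectivization.mk K v.1 v.2 :=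
        continuous_coinduced_rng
      have h2 : Continuous fun v : {v : Fin 2 → K // v ≠ 0} =>
          (⟨g • v.1, (smul_ne_zero_iff_ne g).2 v.2⟩ : {v : Fin 2 → K // v ≠ 0}) :=
        Continuous.subtype_mk
          ((continuous_const.matrix_mulVec continuous_subtype_val : Continuous
            fun v : {v : Fin 2 → K // v ≠ 0} => g.1.mulVec v.1)) _
      exact h1.comp h2

end Tree

/-! ### The product situation

`K i` is a finite family of fields with valuation rings `A i`; the case of interest is the family of
completions `F_𝔭`, `𝔭 ∈ S`, of a number field. -/

section Product

variable {ι : Type*} {K : ι → Type*} [∀ i, Field (K i)]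

variable (K) in
/-- `PGL₂(F_S) = ∏ PGL₂(F_𝔭)`. -/
abbrev PGLS : Type _ := ∀ i, PGL(2, K i)

variable (K) in
/-- `ℙ¹(F_S) = ∏ ℙ¹(F_𝔭)`, with the product topology. -/
abbrev P1S : Type _ := ∀ i, ℙ (K i) (Fin 2 → K i)

/-- Oriented multiedges: `ℰ_S = ∏ ℰ_𝔭`. -/
abbrev MultiEdge (A : ∀ i, ValuationSubring (K i)) : Type _ := ∀ i, Edge (A i)

variable {A : ∀ i, ValuationSubring (K i)}

/-- The set `U_e = ∏ U_{e_𝔭}` attached to a multiedge. -/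
def MultiEdge.ends (e : MultiEdge A) : Set (P1S K) := {x | ∀ i, x i ∈ (e i).ends}

open Classical in
/-- The multiedge obtained from `e` by replacing its component at `i` by `e'`. -/
noncomputable def MultiEdge.replace (e : MultiEdge A) (i : ι) (e' : Edge (A i)) : MultiEdge A :=
  Function.update e i e'

/-- The inversion `e ↦ ē^𝔭` at one component. -/
noncomputable def MultiEdge.flip [∀ i, IsDiscreteValuationRing (A i)] (i : ι) (e : MultiEdge A) :
    MultiEdge A :=
  e.replace i (e i).opp

theorem MultiEdge.smul_replace (g : PGLS K) (e : MultiEdge A) (i : ι) (e' : Edge (A i)) :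
    g • e.replace i e' = MultiEdge.replace (g • e) i (g i • e') := by
  funext j
  by_cases h : j = i
  · subst h; simp [MultiEdge.replace]
  · simp [MultiEdge.replace, h]

theorem MultiEdge.smul_flip [∀ i, IsDiscreteValuationRing (A i)] (g : PGLS K) (i : ι)
    (e : MultiEdge A) : g • e.flip i = MultiEdge.flip i (g • e) :=
  MultiEdge.smul_replace g e i _

/-- The degeneracy map at the component `i`: it sends a function `c` on multiedges to the function
`(v, e) ↦ ∑_{s(e') = v} c(e', e)`, where `v` is a vertex at `i` and `e` is a multiedge away from
`i` (written as a multiedge whose component at `i` is ignored). The trees being locally finite, the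
sum is finite. -/
noncomputable def degeneracy (c : MultiEdge A → ℤ) (i : ι) (v : Vertex (A i))
    (e : MultiEdge A) : ℤ :=
  ∑ᶠ e' : {e' : Edge (A i) // e'.src = v}, c (e.replace i e'.1)

/-- The left translation `(g ⋆ c)(e) = c(g⁻¹ e)`. -/
def translate (g : PGLS K) (c : MultiEdge A → ℤ) : MultiEdge A → ℤ := fun e => c (g⁻¹ • e)

variable [∀ i, IsDiscreteValuationRing (A i)] [∀ i, Finite (IsLocalRing.ResidueField (A i))]

variable (A) in
/-- The group `HC_S(ℤ)` of integral `S`-harmonic cochains, i.e. the kernel of the differential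
`ℱ₀(ℰ_S, ℤ) → ⨁_𝔭 ℱ₀(𝒱_𝔭 × ℰ_{S∖𝔭}, ℤ)`, `c ↦ (φ_𝔭 c)_𝔭` (up to signs): functions `c` on
multiedges which change sign under every inversion and are killed by every degeneracy map. -/
noncomputable def HC : AddSubgroup (MultiEdge A → ℤ) where
  carrier := {c | (∀ i e, c e + c (MultiEdge.flip i e) = 0) ∧ ∀ i v e, degeneracy c i v e = 0}
  zero_mem' := ⟨fun _ _ => add_zero _, fun _ _ _ => finsum_zero⟩
  add_mem' := by
    rintro c d ⟨hc, hc'⟩ ⟨hd, hd'⟩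
    refine ⟨fun i e => ?_, fun i v e => ?_⟩
    · have h1 := hc i e
      have h2 := hd i e
      simp only [Pi.add_apply]
      linarith
    · have h1 := hc' i v e
      have h2 := hd' i v e
      unfold degeneracy at h1 h2 ⊢
      simp only [Pi.add_apply]
      rw [finsum_add_distrib (Set.toFinite _) (Set.toFinite _), h1, h2, add_zero]
  neg_mem' := by
    rintro c ⟨hc, hc'⟩
    refine ⟨fun i e => ?_, fun i v e => ?_⟩
    · have h1 := hc i e
      simp only [Pi.neg_apply]
      linarith
    · have h1 := hc' i v e
      unfold degeneracy at h1 ⊢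
      simp only [Pi.neg_apply]
      rw [finsum_neg_distrib, h1, neg_zero]

theorem translate_mem_HC (g : PGLS K) {c : MultiEdge A → ℤ} (hc : c ∈ HC A) :
    translate g c ∈ HC A := by
  refine ⟨fun i e => ?_, fun i v e => ?_⟩
  · unfold translate
    rw [MultiEdge.smul_flip]
    exact hc.1 i _
  · have h := hc.2 i (g⁻¹ i • v) (g⁻¹ • e)
    unfold degeneracy translate at *
    rw [← h]
    let σ : {e' : Edge (A i) // e'.src = v} ≃ {e' : Edge (A i) // e'.src = g⁻¹ i • v} :=
      (MulAction.toPerm (g⁻¹ i)).subtypeEquiv fun e' => by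
        rw [MulAction.toPerm_apply, Edge.smul_src, smul_left_cancel_iff]
    rw [← finsum_comp_equiv σ]
    refine finsum_congr fun e' => ?_
    rw [MultiEdge.smul_replace]
    rfl

/-- The left action of `PGL₂(F_S)` on harmonic cochains by translation. -/
instance : DistribMulAction (PGLS K) (HC A) where
  smul g c := ⟨translate g c.1, translate_mem_HC g c.2⟩
  one_smul c := Subtype.ext <| funext fun e => by
    change c.1 ((1 : PGLS K)⁻¹ • e) = c.1 e
    rw [inv_one, one_smul]
  mul_smul g h c := Subtype.ext <| funext fun e => by
    change c.1 ((g * h)⁻¹ • e) = c.1 (h⁻¹ • g⁻¹ • e)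
    rw [mul_inv_rev, mul_smul]
  smul_zero _ := rfl
  smul_add _ _ _ := rfl

theorem HC.smul_apply (g : PGLS K) (c : HC A) (e : MultiEdge A) :
    (g • c).1 e = c.1 (g⁻¹ • e) := rfl

end Product

/-! ### Measures -/

section Measures

open TopologicalSpace

/-- Finitely additive `ℤ`-valued functions on the compact open subsets of `X`. -/
def finAddMeasure (X : Type*) [TopologicalSpace X] : AddSubgroup (CompactOpens X → ℤ) where
  carrier := {μ | ∀ U V : CompactOpens X, Disjoint (U : Set X) (V : Set X) →
    μ (U ⊔ V) = μ U + μ V}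
  zero_mem' := fun _ _ _ => rfl
  add_mem' := by
    intro μ ν hμ hν U V h
    simp only [Pi.add_apply]
    rw [hμ U V h, hν U V h]
    ring
  neg_mem' := by
    intro μ hμ U V h
    simp only [Pi.neg_apply]
    rw [hμ U V h]
    ring

variable {ι : Type*} (K : ι → Type*) [∀ i, Field (K i)] [∀ i, TopologicalSpace (K i)]

/-- The group `ℳ(ℙ¹(F_S), ℤ)`: finitely additive `ℤ`-valued functions on the compact open subsets
of `ℙ¹(F_S)` which vanish on every set of the form `ℙ¹(F_𝔭) × V`, with `𝔭 ∈ S` and `V` a compact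
open subset of `ℙ¹(F_{S∖𝔭})`. -/
def plecticMeasure : AddSubgroup (CompactOpens (P1S K) → ℤ) where
  carrier := {μ | μ ∈ finAddMeasure (P1S K) ∧
    ∀ (i : ι) (V : CompactOpens (P1S fun j : {j // j ≠ i} => K j)) (U : CompactOpens (P1S K)),
      (U : Set (P1S K)) = {x | (fun j : {j // j ≠ i} => x j) ∈ V} → μ U = 0}
  zero_mem' := ⟨zero_mem _, fun _ _ _ _ => rfl⟩
  add_mem' := by
    rintro μ ν ⟨hμ, hμ'⟩ ⟨hν, hν'⟩
    refine ⟨add_mem hμ hν, fun i V U h => ?_⟩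
    rw [Pi.add_apply, hμ' i V U h, hν' i V U h, add_zero]
  neg_mem' := by
    rintro μ ⟨hμ, hμ'⟩
    refine ⟨neg_mem hμ, fun i V U h => ?_⟩
    rw [Pi.neg_apply, hμ' i V U h, neg_zero]

variable {K} [∀ i, IsTopologicalRing (K i)]

theorem continuous_smul_P1S (g : PGLS K) : Continuous fun x : P1S K => g • x :=
  continuous_pi fun i => (continuous_const_smul (g i)).comp (continuous_apply i)

theorem isOpenMap_smul_P1S (g : PGLS K) : IsOpenMap fun x : P1S K => g • x :=
  (Homeomorph.mk (MulAction.toPerm g) (continuous_smul_P1S g) (continuous_smul_P1S g⁻¹)).isOpenMap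

/-- The left action `U ↦ g U` of `PGL₂(F_S)` on compact open subsets of `ℙ¹(F_S)`. -/
instance compactOpensAction : MulAction (PGLS K) (CompactOpens (P1S K)) where
  smul g U := U.map (fun x => g • x) (continuous_smul_P1S g) (isOpenMap_smul_P1S g)
  one_smul U := CompactOpens.ext (one_smul (PGLS K) (U : Set (P1S K)))
  mul_smul g h U := CompactOpens.ext (mul_smul g h (U : Set (P1S K)))

theorem coe_smul_compactOpens (g : PGLS K) (U : CompactOpens (P1S K)) :
    ((g • U : CompactOpens (P1S K)) : Set (P1S K)) = g • (U : Set (P1S K)) := rfl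

theorem translate_mem_plecticMeasure (g : PGLS K) {μ : CompactOpens (P1S K) → ℤ}
    (hμ : μ ∈ plecticMeasure K) : (fun U => μ (g⁻¹ • U)) ∈ plecticMeasure K := by
  refine ⟨fun U V h => ?_, fun i V U h => ?_⟩
  · have h1 : g⁻¹ • (U ⊔ V) = g⁻¹ • U ⊔ g⁻¹ • V :=
      CompactOpens.ext (Set.smul_set_union (a := g⁻¹) (t₁ := (U : Set (P1S K))) (t₂ := V))
    change μ (g⁻¹ • (U ⊔ V)) = _
    rw [h1]
    exact hμ.1 _ _ (Set.disjoint_smul_set.2 h)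
  · let g' : PGLS fun j : {j // j ≠ i} => K j := fun j => g j
    refine hμ.2 i (g'⁻¹ • V) _ ?_
    rw [coe_smul_compactOpens, h]
    ext x
    rw [Set.mem_inv_smul_set_iff]
    change _ ↔ (fun j : {j // j ≠ i} => x j) ∈ g'⁻¹ • (V : Set (P1S fun j : {j // j ≠ i} => K j))
    rw [Set.mem_inv_smul_set_iff]
    rfl

/-- The left action `(g ⋆ μ)(U) = μ(g⁻¹ U)` of `PGL₂(F_S)` on `ℳ(ℙ¹(F_S), ℤ)`. -/
instance : DistribMulAction (PGLS K) (plecticMeasure K) where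
  smul g μ := ⟨fun U => μ.1 (g⁻¹ • U), translate_mem_plecticMeasure g μ.2⟩
  one_smul μ := Subtype.ext <| funext fun U => by
    change μ.1 ((1 : PGLS K)⁻¹ • U) = μ.1 U
    rw [inv_one, one_smul]
  mul_smul g h μ := Subtype.ext <| funext fun U => by
    change μ.1 ((g * h)⁻¹ • U) = μ.1 (h⁻¹ • g⁻¹ • U)
    rw [mul_inv_rev, mul_smul]
  smul_zero _ := rfl
  smul_add _ _ _ := rfl

theorem plecticMeasure.smul_apply (g : PGLS K) (μ : plecticMeasure K) (U : CompactOpens (P1S K)) :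
    (g • μ).1 U = μ.1 (g⁻¹ • U) := rfl

end Measures

/-! ### Completions of number fields -/

section NumberField

variable (F : Type*) [Field F] [NumberField F]

/-- The residue field of `𝒪_{F,𝔭}` is finite, being a quotient of `𝒪_F / 𝔭`. -/
instance finite_residueField (𝔭 : HeightOneSpectrum (𝓞 F)) :
    Finite (IsLocalRing.ResidueField (𝔭.adicCompletionIntegers F)) := by
  let O := 𝔭.adicCompletionIntegers F
  let φ : 𝓞 F →+* IsLocalRing.ResidueField O :=
    (IsLocalRing.residue O).comp (algebraMap (𝓞 F) O)
  have hval : ∀ x : O, Valued.v (x : 𝔭.adicCompletion F) < 1 →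
      x ∈ IsLocalRing.maximalIdeal O := by
    intro x hx
    rw [IsLocalRing.mem_maximalIdeal, mem_nonunits_iff,
      HeightOneSpectrum.adicCompletionIntegers.isUnit_iff_valued_eq_one]
    exact hx.ne
  have hker : 𝔭.asIdeal ≤ RingHom.ker φ := by
    intro a ha
    rw [RingHom.mem_ker]
    refine (IsLocalRing.residue_eq_zero_iff _).2 (hval _ ?_)
    rw [HeightOneSpectrum.algebraMap_adicCompletionIntegers_apply,
      HeightOneSpectrum.valuedAdicCompletion_eq_valuation']
    exact (HeightOneSpectrum.valuation_lt_one_iff_mem 𝔭 a).2 ha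
  have hsurj : Function.Surjective φ := by
    intro y
    obtain ⟨x, rfl⟩ := IsLocalRing.residue_surjective y
    have hopen : IsOpen {z : 𝔭.adicCompletion F | Valued.v (z - x) < 1} := by
      have h := (Valued.isOpen_ball (R := 𝔭.adicCompletion F) (Γ₀ := WithZero (Multiplicative ℤ)) 1)
      simp only [Valuation.restrict_lt_one_iff] at h
      exact h.preimage (continuous_id.sub continuous_const)
    obtain ⟨k, hk⟩ := (HeightOneSpectrum.denseRange_algebraMap F 𝔭).exists_mem_open hopen
      ⟨x, by simp⟩
    change Valued.v ((k : 𝔭.adicCompletion F) - x) < 1 at hk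
    have hk1 : 𝔭.valuation F k ≤ 1 := by
      rw [← HeightOneSpectrum.valuedAdicCompletion_eq_valuation',
        ← sub_add_cancel (k : 𝔭.adicCompletion F) x]
      exact Valuation.map_add_le _ hk.le x.2
    obtain ⟨a, ha⟩ := 𝔭.exists_valuation_sub_lt_of_integer hk1 1
    rw [Units.val_one] at ha
    refine ⟨a, ?_⟩
    change IsLocalRing.residue O (algebraMap (𝓞 F) O a) = IsLocalRing.residue O x
    rw [← sub_eq_zero, ← map_sub]
    refine (IsLocalRing.residue_eq_zero_iff _).2 (hval _ ?_)
    have h1 : ((algebraMap (𝓞 F) O a - x : O) : 𝔭.adicCompletion F) =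
        ((algebraMap (𝓞 F) F a - k : F) : 𝔭.adicCompletion F) + ((k : 𝔭.adicCompletion F) - x) := by
      have h2 : ((algebraMap (𝓞 F) F a - k : F) : 𝔭.adicCompletion F) =
          (algebraMap (𝓞 F) F a : 𝔭.adicCompletion F) - (k : 𝔭.adicCompletion F) :=
        map_sub (algebraMap F (𝔭.adicCompletion F)) _ _
      rw [h2, sub_add_sub_cancel]
      rfl
    rw [h1]
    refine Valuation.map_add_lt _ ?_ hk
    rwa [HeightOneSpectrum.valuedAdicCompletion_eq_valuation']
  have : Finite (𝓞 F ⧸ 𝔭.asIdeal) := 𝔭.asIdeal.finiteQuotientOfFreeOfNeBot 𝔭.ne_bot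
  exact Finite.of_surjective (Ideal.Quotient.lift 𝔭.asIdeal φ hker)
    (Ideal.Quotient.lift_surjective_of_surjective _ hker hsurj)

end NumberField

end Plectic

/-! Write `U_e` for `e.ends`. In one tree the primitive vectors of a lattice `Λ` map onto the
projective line, and a neighbour `Λs` of `Λ` is a line in the plane `Λ/𝔭Λ` over the residue field.
Hence a point lies in `U_e`, for `e` ending at the class of `Λ`, exactly when its primitive
representative lies in `Λs` (`Edge.mk_mem_ends_iff`). Two facts follow: the sets `U_e`, for `e`
ending at a fixed vertex, partition the projective line (`Edge.exists_tgt_eq_and_mem_ends`,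
`Edge.eq_of_mem_ends`), and reversing `e` complements `U_e` (`Edge.ends_opp`).

These partitions are precisely the relations defining harmonic cochains. If finitely many discs
partition one factor, then for every choice of discs in the remaining factors the union of the
resulting boxes is a cylinder, on which a measure vanishes. So evaluating a measure on boxes yields
a cochain (`mem_HC_of_mem_plecticMeasure`).

Conversely, fix a root `v₀` in every tree. The edges pointing to the root at distance `n` give discs
partitioning the projective line, each partition refining the previous one, and every edge or its
reverse occurs at some level because the tree is connected. Since discs of high level separate
points, compactness shows that every compact open set is a finite disjoint union of boxes of some
level (`MultiEdge.exists_saturated`). Therefore a finitely additive function is determined by its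
values on boxes (`finAddMeasure_ext`). Given a cochain `c`, the sum of `c` over the level-`n` boxes
in `U` stabilises as `n` grows, because harmonicity makes `c e` the sum of `c` over the children of
`e` (`levelSum_succ`). The stable value is additive in `U`, vanishes on cylinders and returns `c e`
on `U_e`, so it is the required measure. Equivariance comes from uniqueness and `g U_e = U_{g e}`.
-/

namespace Plectic

/-! ### Lattices, bases and neighbours -/

section LatticeGeometry

variable {K : Type*} [Field K] {A : ValuationSubring K}

namespace Lat

/-- The lattice spanned by a basis. -/
def ofBasis (A : ValuationSubring K) (b : Module.Basis (Fin 2) K (Fin 2 → K)) : Lat A where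
  toSubmodule := Submodule.span A (Set.range b)
  isLattice :=
    { fg := Submodule.fg_span (Set.finite_range b)
      span_eq_top := by rw [Submodule.span_span_of_tower, b.span_eq] }

theorem mem_ofBasis (b : Module.Basis (Fin 2) K (Fin 2 → K)) (x : Fin 2 → K) :
    x ∈ (ofBasis A b).toSubmodule ↔ ∀ i, A.valuation (b.repr x i) ≤ 1 := by
  refine (b.mem_span_iff_repr_mem A x).trans (forall_congr' fun i => ?_)
  rw [A.valuation_le_one_iff]
  exact ⟨fun ⟨a, ha⟩ => ha ▸ a.2, fun h => ⟨⟨_, h⟩, rfl⟩⟩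

theorem basis_mem_ofBasis (b : Module.Basis (Fin 2) K (Fin 2 → K)) (i : Fin 2) :
    b i ∈ (ofBasis A b).toSubmodule := Submodule.subset_span ⟨i, rfl⟩

/-- Every lattice has a basis. -/
theorem exists_eq_ofBasis [IsDiscreteValuationRing A] (Λ : Lat A) :
    ∃ b : Module.Basis (Fin 2) K (Fin 2 → K), Λ = ofBasis A b := by
  have := Λ.isLattice
  have hr := Submodule.IsLattice.finrank_of_pi K Λ.toSubmodule
  have : Module.Free A Λ.toSubmodule := Submodule.IsLattice.free K Λ.toSubmodule
  rw [Fintype.card_fin] at hr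
  let b := Module.finBasisOfFinrankEq A Λ.toSubmodule hr
  refine ⟨b.extendOfIsLattice K, ext' ?_⟩
  have h1 : Set.range (b.extendOfIsLattice K) = Λ.toSubmodule.subtype '' Set.range b := by
    rw [← Set.range_comp]
    exact congrArg Set.range (funext fun i => b.extendOfIsLattice_apply K i)
  change _ = Submodule.span A _
  rw [h1, ← Submodule.map_span, b.span_eq, Submodule.map_top, Submodule.range_subtype]

theorem smul_mem_of_valuation_le_one (Λ : Lat A) {k : K} (hk : A.valuation k ≤ 1)
    {x : Fin 2 → K} (hx : x ∈ Λ.toSubmodule) : k • x ∈ Λ.toSubmodule :=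
  Λ.toSubmodule.smul_mem ⟨k, (A.valuation_le_one_iff k).1 hk⟩ hx

theorem smul_mem_pMul_of_valuation_lt_one (Λ : Lat A) {k : K} (hk : A.valuation k < 1)
    {x : Fin 2 → K} (hx : x ∈ Λ.toSubmodule) : k • x ∈ Λ.pMul :=
  Submodule.smul_mem_smul (r := (⟨k, (A.valuation_le_one_iff k).1 hk.le⟩ : A))
    ((A.valuation_lt_one_iff _).2 hk) hx

theorem pMul_le (Λ : Lat A) : Λ.pMul ≤ Λ.toSubmodule := Submodule.smul_le_right

theorem mem_pMul_ofBasis (b : Module.Basis (Fin 2) K (Fin 2 → K)) (x : Fin 2 → K) :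
    x ∈ (ofBasis A b).pMul ↔ ∀ i, A.valuation (b.repr x i) < 1 := by
  constructor
  · intro hx i
    refine Submodule.smul_induction_on hx (fun r hr n hn => ?_) (fun x y hx hy => ?_)
    · have h1 := (A.valuation_lt_one_iff _).1 hr
      have h2 := (mem_ofBasis b n).1 hn i
      have h3 : b.repr (r • n) i = r * b.repr n i := by
        change b.repr ((r : K) • n) i = _
        simp
      rw [h3, map_mul]
      exact mul_lt_one_of_lt_of_le h1 h2
    · rw [map_add, Finsupp.add_apply]
      exact Valuation.map_add_lt _ hx hy
  · intro h
    rw [← b.sum_repr x]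
    exact Submodule.sum_mem _ fun i _ =>
      smul_mem_pMul_of_valuation_lt_one _ (h i) (basis_mem_ofBasis b i)

theorem primitive_ne_zero {Λ : Lat A} {v : Fin 2 → K} (hv : v ∈ Λ.primitive) : v ≠ 0 := by
  rintro rfl
  exact hv.2 Λ.pMul.zero_mem

theorem valuation_eq_one_of_primitive {Λ : Lat A} {v : Fin 2 → K} {k : K}
    (hv : v ∈ Λ.primitive) (hkv : k • v ∈ Λ.primitive) : A.valuation k = 1 := by
  have hk0 : k ≠ 0 := by
    rintro rfl
    exact primitive_ne_zero hkv (zero_smul _ _)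
  refine le_antisymm (le_of_not_gt fun h => ?_) (le_of_not_gt fun h => ?_)
  · have h1 : A.valuation k⁻¹ < 1 := by
      rw [map_inv₀]; exact inv_lt_one_of_one_lt₀ h
    refine hv.2 ?_
    have := smul_mem_pMul_of_valuation_lt_one Λ h1 hkv.1
    rwa [inv_smul_smul₀ hk0] at this
  · exact hkv.2 (smul_mem_pMul_of_valuation_lt_one Λ h hv.1)

theorem Adj.mem_primitive {Λs Λt : Lat A} (h : Λs.Adj Λt) {v : Fin 2 → K}
    (hv : v ∈ Λt.primitive) (hs : v ∈ Λs.toSubmodule) : v ∈ Λs.primitive :=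
  ⟨hs, fun h' => hv.2 (Submodule.smul_mono le_rfl h.2.le h')⟩

/-- Cramer's rule: two vectors whose determinant in the basis `b` is a unit generate the lattice of
`b`. -/
theorem mem_span_pair_of_valuation_eq_one {b : Module.Basis (Fin 2) K (Fin 2 → K)}
    {M : Submodule A (Fin 2 → K)} {v w : Fin 2 → K} (hv : v ∈ (ofBasis A b).toSubmodule)
    (hw : w ∈ (ofBasis A b).toSubmodule) (hvM : v ∈ M) (hwM : w ∈ M)
    (hd : A.valuation (b.repr v 0 * b.repr w 1 - b.repr v 1 * b.repr w 0) = 1) :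
    (ofBasis A b).toSubmodule ≤ M := by
  intro y hy
  set d := b.repr v 0 * b.repr w 1 - b.repr v 1 * b.repr w 0 with hd'
  have hd0 : d ≠ 0 := by
    rintro h; rw [h, map_zero] at hd; exact zero_ne_one hd
  rw [mem_ofBasis] at hv hw hy
  have hle : ∀ p q r s : K, A.valuation p ≤ 1 → A.valuation q ≤ 1 → A.valuation r ≤ 1 →
      A.valuation s ≤ 1 → d⁻¹ * (p * q - r * s) ∈ A := by
    intro p q r s hp hq hr hs
    rw [← A.valuation_le_one_iff, map_mul, map_inv₀, hd, inv_one, one_mul]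
    refine (A.valuation.map_sub _ _).trans (max_le ?_ ?_)
    · rw [map_mul]; exact mul_le_one' hp hq
    · rw [map_mul]; exact mul_le_one' hr hs
  have key : y = (d⁻¹ * (b.repr y 0 * b.repr w 1 - b.repr y 1 * b.repr w 0)) • v +
      (d⁻¹ * (b.repr v 0 * b.repr y 1 - b.repr v 1 * b.repr y 0)) • w := by
    refine b.ext_elem fun i => ?_
    rw [map_add, map_smul, map_smul, Finsupp.add_apply, Finsupp.smul_apply, Finsupp.smul_apply,
      smul_eq_mul, smul_eq_mul]
    field_simp
    fin_cases i
    · simp only [Fin.zero_eta, hd']; ring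
    · simp only [Fin.mk_one, hd']; ring
  rw [key]
  exact M.add_mem (M.smul_mem ⟨_, hle _ _ _ _ (hy 0) (hw 1) (hy 1) (hw 0)⟩ hvM)
    (M.smul_mem ⟨_, hle _ _ _ _ (hv 0) (hy 1) (hv 1) (hy 0)⟩ hwM)

/-- Modulo `𝔭Λ` the neighbour `Λs` is the line through `v`, and the vanishing of a determinant
detects that line. This describes `Λs` by `v` alone, which gives `Adj.unique`. -/
theorem Adj.mem_iff {Λs : Lat A} {b : Module.Basis (Fin 2) K (Fin 2 → K)}
    (h : Λs.Adj (ofBasis A b)) {v : Fin 2 → K} (hv : v ∈ (ofBasis A b).primitive)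
    (hvs : v ∈ Λs.toSubmodule) (x : Fin 2 → K) : x ∈ Λs.toSubmodule ↔
      x ∈ (ofBasis A b).toSubmodule ∧
        A.valuation (b.repr v 0 * b.repr x 1 - b.repr v 1 * b.repr x 0) < 1 := by
  have hv1 := (mem_ofBasis b v).1 hv.1
  constructor
  · intro hx
    refine ⟨h.2.le hx, lt_of_le_of_ne ?_ fun hd =>
      h.2.not_ge (mem_span_pair_of_valuation_eq_one hv.1 (h.2.le hx) hvs hx hd)⟩
    have hx1 := (mem_ofBasis b x).1 (h.2.le hx)
    refine (A.valuation.map_sub _ _).trans (max_le ?_ ?_)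
    · rw [map_mul]; exact mul_le_one' (hv1 _) (hx1 _)
    · rw [map_mul]; exact mul_le_one' (hv1 _) (hx1 _)
  · rintro ⟨hx, hd⟩
    have hx1 := (mem_ofBasis b x).1 hx
    have hv2 := hv.2
    rw [mem_pMul_ofBasis] at hv2
    push Not at hv2
    obtain ⟨j, hj⟩ := hv2
    have hj1 : A.valuation (b.repr v j) = 1 := le_antisymm (hv1 j) hj
    have hj0 : b.repr v j ≠ 0 := by
      intro h; rw [h, map_zero] at hj1; exact zero_ne_one hj1
    -- Clear a coordinate `j` at which `v` is a unit. After multiplication by `v_j`, the remaining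
    -- coordinate is the determinant up to sign, so the difference lies in `𝔭Λ ⊆ Λs`.
    have h1 : x - ((b.repr v j)⁻¹ * b.repr x j) • v ∈ (ofBasis A b).pMul := by
      rw [mem_pMul_ofBasis]
      intro i
      have h2 : A.valuation (b.repr v j * b.repr (x - ((b.repr v j)⁻¹ * b.repr x j) • v) i) < 1 := by
        have h3 : b.repr v j * b.repr (x - ((b.repr v j)⁻¹ * b.repr x j) • v) i =
            b.repr v j * b.repr x i - b.repr v i * b.repr x j := by
          rw [map_sub, map_smul, Finsupp.sub_apply, Finsupp.smul_apply, smul_eq_mul]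
          field_simp
        rw [h3]
        fin_cases i <;> fin_cases j <;> simp only [Fin.zero_eta, Fin.mk_one]
        · rw [sub_self, map_zero]; exact zero_lt_one
        · rw [← Valuation.map_neg, neg_sub]; exact hd
        · exact hd
        · rw [sub_self, map_zero]; exact zero_lt_one
      rwa [map_mul, hj1, one_mul] at h2
    have h4 := Λs.toSubmodule.add_mem (h.1.le h1) (Λs.smul_mem_of_valuation_le_one (x := v)
      (k := (b.repr v j)⁻¹ * b.repr x j) (by rw [map_mul, map_inv₀, hj1, inv_one, one_mul]; exact hx1 j)
      hvs)
    rwa [sub_add_cancel] at h4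

variable [IsDiscreteValuationRing A]

/-- Every line contains a primitive vector. -/
theorem exists_smul_primitive (Λ : Lat A) {v : Fin 2 → K} (hv : v ≠ 0) :
    ∃ k : K, k ≠ 0 ∧ k • v ∈ Λ.primitive := by
  obtain ⟨b, rfl⟩ := Λ.exists_eq_ofBasis
  obtain ⟨j, hj⟩ := Finite.exists_max fun i => A.valuation (b.repr v i)
  have h0 : b.repr v j ≠ 0 := by
    intro h
    refine hv (b.repr.map_eq_zero_iff.1 (Finsupp.ext fun i => ?_))
    have := hj i
    rw [h, map_zero, le_zero_iff, map_eq_zero] at this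
    exact this
  have h1 : A.valuation (b.repr v j) ≠ 0 := by rwa [Ne, map_eq_zero]
  refine ⟨(b.repr v j)⁻¹, inv_ne_zero h0, ?_, ?_⟩
  · rw [mem_ofBasis]
    intro i
    rw [map_smul, Finsupp.smul_apply, smul_eq_mul, map_mul, map_inv₀, inv_mul_le_one₀ (zero_lt_iff.2 h1)]
    exact hj i
  · rw [mem_pMul_ofBasis]
    intro h
    have := h j
    rw [map_smul, Finsupp.smul_apply, smul_eq_mul, inv_mul_cancel₀ h0, map_one] at this
    exact lt_irrefl _ this

/-- Two neighbours of `Λ` which share a primitive vector of `Λ` are equal. -/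
theorem Adj.unique {Λ₁ Λ₂ Λ : Lat A} (h₁ : Λ₁.Adj Λ) (h₂ : Λ₂.Adj Λ) {v : Fin 2 → K}
    (hv : v ∈ Λ.primitive) (hv₁ : v ∈ Λ₁.toSubmodule) (hv₂ : v ∈ Λ₂.toSubmodule) : Λ₁ = Λ₂ := by
  obtain ⟨b, rfl⟩ := Λ.exists_eq_ofBasis
  exact ext' (Submodule.ext fun x => (h₁.mem_iff hv hv₁ x).trans (h₂.mem_iff hv hv₂ x).symm)

/-- A primitive vector of `Λ` lies in a neighbour of `Λ`. -/
theorem exists_adj_mem (Λ : Lat A) {v : Fin 2 → K} (hv : v ∈ Λ.primitive) :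
    ∃ Λ' : Lat A, Λ'.Adj Λ ∧ v ∈ Λ'.toSubmodule := by
  obtain ⟨a, ha⟩ := exists_pMul_eq_smul (A := A)
  have hp : Submodule.IsLattice K Λ.pMul := by rw [ha]; exact (a • Λ).isLattice
  -- The neighbour is the preimage in `Λ` of the line spanned by `v` in `Λ/𝔭Λ`.
  refine ⟨⟨Submodule.span A {v} ⊔ Λ.pMul, Submodule.IsLattice.of_le_of_isLattice_of_fg K le_sup_right
    ((Submodule.fg_span_singleton v).sup hp.fg)⟩, ⟨?_, ?_⟩,
    Submodule.mem_sup_left (Submodule.mem_span_singleton_self v)⟩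
  · refine lt_of_le_of_ne le_sup_right fun h => hv.2 ?_
    rw [h]
    exact Submodule.mem_sup_left (Submodule.mem_span_singleton_self v)
  · refine lt_of_le_of_ne (sup_le ?_ Λ.pMul_le) fun h => ?_
    · rw [Submodule.span_singleton_le_iff_mem]; exact hv.1
    · replace h : Submodule.span A {v} ⊔ Λ.pMul = Λ.toSubmodule := h
      obtain ⟨b, rfl⟩ := Λ.exists_eq_ofBasis
      -- If `v` and `𝔭Λ` generated `Λ`, every determinant of `v` with a vector of `Λ` would lie in
      -- `𝔭`. Testing on the two basis vectors puts both coordinates of `v` in `𝔭`, against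
      -- primitivity.
      have hd : ∀ x ∈ (ofBasis A b).toSubmodule,
          A.valuation (b.repr v 0 * b.repr x 1 - b.repr v 1 * b.repr x 0) < 1 := by
        intro x hx
        rw [← h] at hx
        obtain ⟨y, hy, z, hz, rfl⟩ := Submodule.mem_sup.1 hx
        obtain ⟨r, rfl⟩ := Submodule.mem_span_singleton.1 hy
        rw [mem_pMul_ofBasis] at hz
        have hv1 := (mem_ofBasis b v).1 hv.1
        have h1 : b.repr v 0 * b.repr (r • v + z) 1 - b.repr v 1 * b.repr (r • v + z) 0 =
            b.repr v 0 * b.repr z 1 - b.repr v 1 * b.repr z 0 := by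
          change b.repr v 0 * b.repr ((r : K) • v + z) 1 - b.repr v 1 * b.repr ((r : K) • v + z) 0 = _
          simp only [map_add, map_smul, Finsupp.add_apply, Finsupp.smul_apply, smul_eq_mul]
          ring
        rw [h1]
        refine (A.valuation.map_sub _ _).trans_lt (max_lt ?_ ?_)
        · rw [mul_comm, map_mul]; exact mul_lt_one_of_lt_of_le (hz _) (hv1 _)
        · rw [mul_comm, map_mul]; exact mul_lt_one_of_lt_of_le (hz _) (hv1 _)
      have h0 := hd _ (basis_mem_ofBasis b 0)
      have h1 := hd _ (basis_mem_ofBasis b 1)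
      refine hv.2 ((mem_pMul_ofBasis b v).2 fun i => ?_)
      fin_cases i
      · simpa using h1
      · simpa using h0

end Lat

/-! ### Edges and their discs in the projective line; connectedness of the tree -/

namespace Edge

/-- An edge ending at the class of `Λ` has a source represented by a neighbour of `Λ`. -/
theorem exists_adj_of_tgt_eq (e : Edge A) {Λ : Lat A} (h : Vertex.mk Λ = e.tgt) :
    ∃ Λs : Lat A, Vertex.mk Λs = e.src ∧ Λs.Adj Λ := by
  obtain ⟨Λ₁, Λ₂, h₁, h₂, h₁₂⟩ := e.adj
  obtain ⟨a, ha⟩ := Quotient.exact' (h.trans h₂.symm)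
  change a • Λ₂ = Λ at ha
  exact ⟨a • Λ₁, (Vertex.mk_smul _ _).trans h₁, ha ▸ h₁₂.smul a⟩

theorem smul_tgt (g : PGL(2, K)) (e : Edge A) : (g • e).tgt = g • e.tgt := rfl

theorem smul_mem_smul_ends (g : PGL(2, K)) {e : Edge A} {x : ℙ K (Fin 2 → K)} (hx : x ∈ e.ends) :
    g • x ∈ (g • e).ends := by
  induction g using Matrix.ProjGenLinGroup.induction_on with
  | mk g =>
    obtain ⟨Λs, Λt, hs, ht, h, v, hv, ⟨hvs, hvt⟩, rfl⟩ := hx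
    have hprim : ∀ Λ : Lat A, v ∈ Λ.primitive → g • v ∈ (g • Λ).primitive := by
      rintro Λ ⟨h1, h2⟩
      refine ⟨Submodule.smul_mem_pointwise_smul _ _ _ h1, fun h3 => h2 ?_⟩
      rw [Lat.pMul_gl_smul] at h3
      exact (Set.smul_mem_smul_set_iff (a := g) (s := (Λ.pMul : Set (Fin 2 → K)))).1 h3
    exact ⟨g • Λs, g • Λt, by rw [smul_src, ← hs]; rfl, by rw [smul_tgt, ← ht]; rfl, h.gl_smul g, g • v,
      (smul_ne_zero_iff_ne g).2 hv, ⟨hprim _ hvs, hprim _ hvt⟩, rfl⟩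

theorem smul_ends (g : PGL(2, K)) (e : Edge A) : (g • e).ends = g • e.ends := by
  ext x
  rw [Set.mem_smul_set_iff_inv_smul_mem]
  constructor
  · intro hx
    have := smul_mem_smul_ends g⁻¹ hx
    rwa [inv_smul_smul] at this
  · intro hx
    have := smul_mem_smul_ends g hx
    rwa [smul_inv_smul] at this

/-- Primitive vectors on the same line differ by a unit, so one representative decides membership.
Primitivity in `Λs` is then automatic, because `𝔭Λs ⊆ 𝔭Λt`. -/
theorem mk_mem_ends_iff (e : Edge A) {Λs Λt : Lat A} (hs : Vertex.mk Λs = e.src)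
    (ht : Vertex.mk Λt = e.tgt) (h : Λs.Adj Λt) {v : Fin 2 → K} (hv : v ∈ Λt.primitive)
    (hv0 : v ≠ 0) : Projectivization.mk K v hv0 ∈ e.ends ↔ v ∈ Λs.toSubmodule := by
  rw [ends_eq e hs ht h]
  constructor
  · rintro ⟨w, hw0, ⟨hws, hwt⟩, hvw⟩
    obtain ⟨k, rfl⟩ := (Projectivization.mk_eq_mk_iff' K v w hv0 hw0).1 hvw
    exact Λs.smul_mem_of_valuation_le_one (Lat.valuation_eq_one_of_primitive hwt hv).le hws.1
  · intro hvs
    exact ⟨v, hv0, ⟨h.mem_primitive hv hvs, hv⟩, rfl⟩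

theorem ends_nonempty (e : Edge A) : e.ends.Nonempty := by
  obtain ⟨Λs, Λt, hs, ht, h⟩ := e.adj
  obtain ⟨v, hvs, hv⟩ := SetLike.exists_of_lt h.1
  have hvt : v ∈ Λt.primitive := ⟨h.2.le hvs, hv⟩
  exact ⟨_, (mk_mem_ends_iff e hs ht h hvt (Lat.primitive_ne_zero hvt)).2 hvs⟩

variable [IsDiscreteValuationRing A]

theorem _root_.Plectic.Lat.exists_mk_eq (Λ : Lat A) (x : ℙ K (Fin 2 → K)) :
    ∃ (v : Fin 2 → K) (hv : v ∈ Λ.primitive),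
      x = Projectivization.mk K v (Lat.primitive_ne_zero hv) := by
  induction x using Projectivization.ind with
  | h v hv =>
    obtain ⟨k, -, hk⟩ := Λ.exists_smul_primitive hv
    refine ⟨k • v, hk, ?_⟩
    symm
    rw [Projectivization.mk_eq_mk_iff']
    exact ⟨k, rfl⟩

theorem exists_tgt_eq_and_mem_ends (v : Vertex A) (x : ℙ K (Fin 2 → K)) :
    ∃ e : Edge A, e.tgt = v ∧ x ∈ e.ends := by
  obtain ⟨Λ⟩ := v
  obtain ⟨v, hv, rfl⟩ := Λ.exists_mk_eq x
  obtain ⟨Λ', h, hv'⟩ := Λ.exists_adj_mem hv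
  exact ⟨⟨Vertex.mk Λ', Vertex.mk Λ, Λ', Λ, rfl, rfl, h⟩, rfl,
    (mk_mem_ends_iff _ rfl rfl h hv _).2 hv'⟩

/-- A common point has a representative primitive in the common target lattice, and that vector
determines the neighbour containing it. -/
theorem eq_of_mem_ends {e e' : Edge A} (h : e.tgt = e'.tgt) {x : ℙ K (Fin 2 → K)}
    (hx : x ∈ e.ends) (hx' : x ∈ e'.ends) : e = e' := by
  obtain ⟨Λ, hΛ⟩ := Quotient.exists_rep e.tgt
  obtain ⟨Λ₁, h₁, hadj₁⟩ := e.exists_adj_of_tgt_eq hΛ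
  obtain ⟨Λ₂, h₂, hadj₂⟩ := e'.exists_adj_of_tgt_eq (hΛ.trans h)
  obtain ⟨v, hv, rfl⟩ := Λ.exists_mk_eq x
  rw [mk_mem_ends_iff _ h₁ hΛ hadj₁ hv] at hx
  rw [mk_mem_ends_iff _ h₂ (hΛ.trans h) hadj₂ hv] at hx'
  have := hadj₁.unique hadj₂ hv hx hx'
  subst this
  exact Edge.ext (h₁.symm.trans h₂) h

/-- With `a` a uniformizer, the reverse edge is `aΛt ⊂ Λs`. For `v` primitive in `Λt`: if `v ∈ Λs`,
then `v` represents the point for both edges and is not in `aΛt`; otherwise `a v` is primitive in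
`Λs` and lies in `aΛt`. -/
theorem ends_opp (e : Edge A) : e.opp.ends = e.endsᶜ := by
  obtain ⟨Λs, Λt, hs, ht, h⟩ := e.adj
  obtain ⟨a, ha⟩ := Lat.exists_pMul_eq_smul (A := A)
  have h' : (a • Λt).Adj Λs :=
    ⟨by rw [ha]; exact Lat.smul_lt a h.2, by rw [Lat.smul_toSubmodule, ← ha]; exact h.1⟩
  ext x
  obtain ⟨v, hv, rfl⟩ := Λt.exists_mk_eq x
  have hv0 := Lat.primitive_ne_zero hv
  rw [Set.mem_compl_iff, mk_mem_ends_iff e hs ht h hv]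
  have key : ∀ {w : Fin 2 → K} (hw : w ∈ Λs.primitive) (hw0 : w ≠ 0),
      Projectivization.mk K w hw0 ∈ e.opp.ends ↔ w ∈ (a • Λt).toSubmodule := fun hw hw0 =>
    mk_mem_ends_iff e.opp ((Vertex.mk_smul a Λt).trans ht) hs h' hw hw0
  by_cases hvs : v ∈ Λs.toSubmodule
  · rw [key (h.mem_primitive hv hvs), Lat.smul_toSubmodule, ← ha]
    exact iff_of_false hv.2 (not_not.2 hvs)
  · refine iff_of_true ?_ hvs
    have h1 : a • v ∈ (a • Λt).toSubmodule := Submodule.smul_mem_pointwise_smul _ _ _ hv.1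
    have h2 : a • v ∈ Λs.primitive := by
      refine ⟨h'.2.le h1, fun h3 => hvs ?_⟩
      rw [ha] at h3
      exact (Set.smul_mem_smul_set_iff (a := a) (s := (Λs.toSubmodule : Set (Fin 2 → K)))).1 h3
    have h4 : Projectivization.mk K v hv0 =
        Projectivization.mk K (a • v) (Lat.primitive_ne_zero h2) := by
      symm
      rw [Projectivization.mk_eq_mk_iff]
      exact ⟨a, rfl⟩
    rw [h4, key h2]
    exact h1

variable (A) in
/-- The sets `U_e` separate the points of `ℙ¹(K)`. -/
theorem exists_mem_ends_notMem_ends {x y : ℙ K (Fin 2 → K)} (hxy : x ≠ y) :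
    ∃ e : Edge A, x ∈ e.ends ∧ y ∉ e.ends := by
  induction x using Projectivization.ind with
  | h v hv =>
  induction y using Projectivization.ind with
  | h w hw =>
    have hli : LinearIndependent K ![v, w] := by
      rw [LinearIndependent.pair_iff' hv]
      rintro k rfl
      exact hxy ((Projectivization.mk_eq_mk_iff' K _ _ _ _).2
        ⟨k⁻¹, inv_smul_smul₀ (by rintro rfl; exact hw (zero_smul _ _)) v⟩)
    let b := basisOfLinearIndependentOfCardEqFinrank hli (by simp)
    have hb0 : b 0 = v := by simp [b]
    have hb1 : b 1 = w := by simp [b]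
    have hp : ∀ i, b i ∈ (Lat.ofBasis A b).primitive := by
      refine fun i => ⟨Lat.basis_mem_ofBasis b i, fun h => ?_⟩
      have := (Lat.mem_pMul_ofBasis b _).1 h i
      simp at this
    have hvp := hp 0
    have hwp := hp 1
    rw [hb0] at hvp
    rw [hb1] at hwp
    obtain ⟨Λ', h, hv'⟩ := (Lat.ofBasis A b).exists_adj_mem hvp
    refine ⟨⟨Vertex.mk Λ', Vertex.mk (Lat.ofBasis A b), Λ', _, rfl, rfl, h⟩,
      (mk_mem_ends_iff _ rfl rfl h hvp _).2 hv', fun hy => ?_⟩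
    -- A neighbour of the lattice spanned by `v` and `w` cannot contain both vectors without being
    -- the whole lattice.
    have hw' := (mk_mem_ends_iff _ rfl rfl h hwp _).1 hy
    refine h.2.not_ge (Submodule.span_le.2 ?_)
    rintro _ ⟨i, rfl⟩
    fin_cases i
    · change b 0 ∈ _; rw [hb0]; exact hv'
    · change b 1 ∈ _; rw [hb1]; exact hw'

theorem exists_uniformizer (A : ValuationSubring K) [IsDiscreteValuationRing A] :
    ∃ a : Kˣ, A.valuation a < 1 ∧ (∀ Λ : Lat A, Λ.pMul = a • Λ.toSubmodule) ∧
      ∀ k : K, k ≠ 0 → ∃ n : ℕ, A.valuation ((a : K) ^ n) ≤ A.valuation k := by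
  obtain ⟨ϖ, hϖ⟩ := IsDiscreteValuationRing.exists_irreducible A
  have h0 : (ϖ : K) ≠ 0 := fun h => hϖ.ne_zero (Subtype.ext h)
  refine ⟨Units.mk0 (ϖ : K) h0, (A.valuation_lt_one_iff ϖ).1 ?_, fun Λ => ?_, fun k hk => ?_⟩
  · rw [hϖ.maximalIdeal_eq]; exact Ideal.mem_span_singleton_self ϖ
  · unfold Lat.pMul
    rw [hϖ.maximalIdeal_eq, Submodule.ideal_span_singleton_smul]
    rfl
  · rcases le_total (A.valuation k) 1 with h | h
    · have hk' : (⟨k, (A.valuation_le_one_iff k).1 h⟩ : A) ≠ 0 := fun h' => hk (congrArg Subtype.val h')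
      obtain ⟨n, hn⟩ := IsDiscreteValuationRing.associated_pow_irreducible hk' hϖ
      obtain ⟨u, hu⟩ := hn
      have hu' : k * (u : A) = (ϖ : K) ^ n := congrArg Subtype.val hu
      refine ⟨n, ?_⟩
      rw [Units.val_mk0, ← hu', map_mul]
      exact mul_le_of_le_one_right' (A.valuation_le_one _)
    · exact ⟨0, by simpa using h⟩

theorem _root_.Plectic.Lat.exists_smul_le (Λ Λ' : Lat A) :
    ∃ k : Kˣ, (k • Λ).toSubmodule ≤ Λ'.toSubmodule := by
  obtain ⟨b, rfl⟩ := Λ.exists_eq_ofBasis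
  choose k hk0 hk using fun i => Λ'.exists_smul_primitive (b.ne_zero i)
  -- The scalar of least valuation brings every basis vector into `Λ'` at once.
  obtain ⟨j, hj⟩ := Finite.exists_min fun i => A.valuation (k i)
  refine ⟨Units.mk0 (k j) (hk0 j), ?_⟩
  rintro _ ⟨x, hx, rfl⟩
  replace hx := (Lat.mem_ofBasis b x).1 hx
  change k j • x ∈ Λ'.toSubmodule
  rw [← b.sum_repr x, Finset.smul_sum]
  refine Submodule.sum_mem _ fun i _ => ?_
  rw [smul_comm]
  refine Λ'.smul_mem_of_valuation_le_one (hx i) ?_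
  have h1 : k j • b i = (k j * (k i)⁻¹) • k i • b i := by
    rw [smul_smul, inv_mul_cancel_right₀ (hk0 i)]
  rw [h1]
  refine Λ'.smul_mem_of_valuation_le_one ?_ (hk i).1
  rw [map_mul, map_inv₀]
  exact mul_inv_le_one_of_le₀ (hj i) zero_le

/-- The tree is connected. -/
theorem vertex_induction {P : Vertex A → Prop} {v₀ : Vertex A} (h₀ : P v₀)
    (h : ∀ e : Edge A, P e.tgt → P e.src) (v : Vertex A) : P v := by
  obtain ⟨Λ₀, rfl⟩ := Quotient.exists_rep v₀
  change P (Vertex.mk Λ₀) at h₀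
  obtain ⟨a, ha1, ha, hpow⟩ := exists_uniformizer A
  have hle : ∀ n : ℕ, (a ^ n • Λ₀).toSubmodule ≤ Λ₀.toSubmodule := by
    rintro n _ ⟨x, hx, rfl⟩
    refine Λ₀.smul_mem_of_valuation_le_one ?_ hx
    rw [Units.val_pow_eq_pow_val, map_pow]
    exact pow_le_one' ha1.le n
  -- Between `aⁿ⁺¹Λ₀` and `Λ₀`, pass from `L` to `L' = L + aⁿΛ₀`. Since `𝔭L' ⊆ L ⊆ L'`, either the
  -- two classes coincide or they are joined by an edge, and `L'` falls under the case `n`.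
  have key : ∀ (n : ℕ) (L : Lat A), (a ^ n • Λ₀).toSubmodule ≤ L.toSubmodule →
      L.toSubmodule ≤ Λ₀.toSubmodule → P (Vertex.mk L) := by
    intro n
    induction n with
    | zero =>
      intro L h1 h2
      rw [pow_zero, one_smul] at h1
      rwa [Lat.ext' (le_antisymm h2 h1)]
    | succ n ih =>
      intro L h1 h2
      have i1 := L.isLattice
      have i2 := (a ^ n • Λ₀).isLattice
      let L' : Lat A := ⟨L.toSubmodule ⊔ (a ^ n • Λ₀).toSubmodule, inferInstance⟩
      have hL' : P (Vertex.mk L') := ih L' le_sup_right (sup_le h2 (hle n))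
      have hLL' : L.toSubmodule ≤ L'.toSubmodule := le_sup_left
      have hpL : L'.pMul ≤ L.toSubmodule := by
        change IsLocalRing.maximalIdeal A • (_ ⊔ _) ≤ _
        rw [Submodule.smul_sup]
        refine sup_le L.pMul_le ?_
        change (a ^ n • Λ₀).pMul ≤ _
        rw [ha, ← Lat.smul_toSubmodule, smul_smul, ← pow_succ']
        exact h1
      rcases hLL'.eq_or_lt with h3 | h3
      · rwa [Lat.ext' h3]
      · rcases hpL.eq_or_lt with h4 | h4
        · rw [ha] at h4
          rw [← Lat.ext' (Λ := a • L') h4, Vertex.mk_smul]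
          exact hL'
        · exact h ⟨Vertex.mk L, Vertex.mk L', L, L', rfl, rfl, h4, h3⟩ hL'
  obtain ⟨L, rfl⟩ := Quotient.exists_rep v
  change P (Vertex.mk L)
  -- Any two lattices are commensurable: a multiple of `L` lies in `Λ₀` and contains some `aⁿΛ₀`, so
  -- `key` applies to it.
  obtain ⟨k, hk⟩ := L.exists_smul_le Λ₀
  obtain ⟨k', hk'⟩ := Λ₀.exists_smul_le (k • L)
  obtain ⟨n, hn⟩ := hpow k' k'.ne_zero
  rw [← Vertex.mk_smul k L]
  refine key n _ ?_ hk
  rintro _ ⟨x, hx, rfl⟩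
  have h1 : k' • x ∈ (k • L).toSubmodule := hk' (Submodule.smul_mem_pointwise_smul _ _ _ hx)
  have h2 : A.valuation ((a : K) ^ n * (k' : K)⁻¹) ≤ 1 := by
    rw [map_mul, map_inv₀]
    exact mul_inv_le_one_of_le₀ hn zero_le
  have h3 := (k • L).smul_mem_of_valuation_le_one h2 h1
  have h4 : ((a : K) ^ n * (k' : K)⁻¹) • k' • x = (a ^ n) • x := by
    rw [Units.smul_def, smul_smul, inv_mul_cancel_right₀ k'.ne_zero, Units.smul_def,
      Units.val_pow_eq_pow_val]
  rw [h4] at h3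
  exact h3

end Edge

end LatticeGeometry
-- Topology of lattices, discs and the projective line
section Topology

variable {K : Type*} [Field K] [TopologicalSpace K] [IsTopologicalRing K]
  {A : ValuationSubring K} [IsDiscreteValuationRing A]

theorem Lat.isClopen (hA : IsOpen (A : Set K)) (Λ : Lat A) :
    IsClopen (Λ.toSubmodule : Set (Fin 2 → K)) := by
  obtain ⟨b, rfl⟩ := Λ.exists_eq_ofBasis
  have hA' : IsClopen (A : Set K) := ⟨A.toSubring.toAddSubgroup.isClosed_of_isOpen hA, hA⟩
  have h1 : ((ofBasis A b).toSubmodule : Set (Fin 2 → K)) = ⋂ i, b.coord i ⁻¹' (A : Set K) := by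
    ext x
    rw [SetLike.mem_coe, mem_ofBasis, Set.mem_iInter]
    exact forall_congr' fun i => A.valuation_le_one_iff _
  rw [h1]
  exact isClopen_iInter_of_finite fun i => hA'.preimage (b.coord i).continuous_on_pi

theorem Lat.isCompact [CompactSpace A] (Λ : Lat A) :
    IsCompact (Λ.toSubmodule : Set (Fin 2 → K)) := by
  obtain ⟨b, rfl⟩ := Λ.exists_eq_ofBasis
  have h1 : ((ofBasis A b).toSubmodule : Set (Fin 2 → K)) =
      Set.range fun c : Fin 2 → A => ∑ i, (c i : K) • b i := by
    ext x
    rw [SetLike.mem_coe, mem_ofBasis]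
    constructor
    · exact fun h => ⟨fun i => ⟨b.repr x i, (A.valuation_le_one_iff _).1 (h i)⟩, b.sum_repr x⟩
    · rintro ⟨c, rfl⟩ i
      rw [b.repr_sum_self]
      exact A.valuation_le_one _
  rw [h1]
  exact isCompact_range (by fun_prop)

theorem Lat.isClopen_pMul (hA : IsOpen (A : Set K)) (Λ : Lat A) :
    IsClopen (Λ.pMul : Set (Fin 2 → K)) := by
  obtain ⟨a, ha⟩ := Lat.exists_pMul_eq_smul (A := A)
  rw [ha]
  exact (a • Λ).isClopen hA

theorem Lat.isClopen_primitive (hA : IsOpen (A : Set K)) (Λ : Lat A) : IsClopen Λ.primitive :=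
  (Λ.isClopen hA).diff (Λ.isClopen_pMul hA)

theorem Edge.isOpen_ends (hA : IsOpen (A : Set K)) (e : Edge A) : IsOpen e.ends := by
  obtain ⟨Λs, Λt, hs, ht, h⟩ := e.adj
  rw [Edge.ends_eq e hs ht h, isOpen_coinduced]
  -- The preimage of `U_e` among nonzero vectors consists of the vectors having some multiple
  -- primitive in both lattices, hence is a union of open sets indexed by that multiple.
  have h1 : IsOpen (⋃ k : Kˣ, (fun v : {v : Fin 2 → K // v ≠ 0} => k • v.1) ⁻¹'
      (Λs.primitive ∩ Λt.primitive)) := by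
    refine isOpen_iUnion fun k => IsOpen.preimage ?_
      ((Λs.isClopen_primitive hA).isOpen.inter (Λt.isClopen_primitive hA).isOpen)
    exact (continuous_const_smul (k : K)).comp continuous_subtype_val
  convert h1 using 1
  ext ⟨v, hv⟩
  simp only [Set.mem_preimage, Set.mem_ofPred_eq, Set.mem_iUnion]
  constructor
  · rintro ⟨w, hw, hm, hvw⟩
    obtain ⟨k, rfl⟩ := (Projectivization.mk_eq_mk_iff K w v hw hv).1 hvw.symm
    exact ⟨k, hm⟩
  · rintro ⟨k, hm⟩
    refine ⟨k • v, (smul_ne_zero_iff_ne k).2 hv, hm, ?_⟩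
    symm
    rw [Projectivization.mk_eq_mk_iff]
    exact ⟨k, rfl⟩

theorem Edge.isClopen_ends (hA : IsOpen (A : Set K)) (e : Edge A) : IsClopen e.ends :=
  ⟨⟨e.ends_opp ▸ e.opp.isOpen_ends hA⟩, e.isOpen_ends hA⟩

theorem t2Space_projectivization (hA : IsOpen (A : Set K)) : T2Space (ℙ K (Fin 2 → K)) where
  t2 := by
    intro x y hxy
    obtain ⟨e, hx, hy⟩ := Edge.exists_mem_ends_notMem_ends A hxy
    exact ⟨e.ends, e.endsᶜ, e.isOpen_ends hA, (e.isClopen_ends hA).compl.isOpen, hx, hy,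
      disjoint_compl_right⟩

/-- The primitive vectors of a single lattice are compact and already map onto the projective line.
-/
theorem compactSpace_projectivization (hA : IsOpen (A : Set K)) [CompactSpace A] :
    CompactSpace (ℙ K (Fin 2 → K)) where
  isCompact_univ := by
    let Λ := Lat.ofBasis A (Pi.basisFun K (Fin 2))
    have h1 : IsCompact Λ.primitive := Λ.isCompact.diff (Λ.isClopen_pMul hA).isOpen
    have h2 : IsCompact {v : {v : Fin 2 → K // v ≠ 0} | v.1 ∈ Λ.primitive} := by
      rw [Topology.IsEmbedding.subtypeVal.isCompact_iff]
      convert h1 using 1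
      ext v
      constructor
      · rintro ⟨w, hw, rfl⟩; exact hw
      · exact fun hv => ⟨⟨v, Lat.primitive_ne_zero hv⟩, hv, rfl⟩
    have h3 : Continuous fun v : {v : Fin 2 → K // v ≠ 0} => Projectivization.mk K v.1 v.2 :=
      continuous_coinduced_rng
    convert h2.image h3 using 1
    symm
    rw [Set.eq_univ_iff_forall]
    intro x
    obtain ⟨v, hv, rfl⟩ := Λ.exists_mk_eq x
    exact ⟨⟨v, Lat.primitive_ne_zero hv⟩, hv, rfl⟩

end Topology

/-! ### Openness and compactness of the local rings of integers -/

section NumberField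

variable (F : Type*) [Field F] [NumberField F]

theorem isOpen_adicCompletionIntegers (𝔭 : HeightOneSpectrum (𝓞 F)) :
    IsOpen (𝔭.adicCompletionIntegers F : Set (𝔭.adicCompletion F)) :=
  Valued.isOpen_valuationSubring _

instance compactSpace_adicCompletionIntegers (𝔭 : HeightOneSpectrum (𝓞 F)) :
    CompactSpace (𝔭.adicCompletionIntegers F) := by
  refine (Valued.integer.compactSpace_iff_completeSpace_and_isDiscreteValuationRing_and_finite_residueField
    (K := 𝔭.adicCompletion F)).2
    ⟨?_, inferInstanceAs (IsDiscreteValuationRing (𝔭.adicCompletionIntegers F)),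
      finite_residueField F 𝔭⟩
  have := (isOpen_adicCompletionIntegers F 𝔭)
  have h : IsClosed (𝔭.adicCompletionIntegers F : Set (𝔭.adicCompletion F)) :=
    (𝔭.adicCompletionIntegers F).toSubring.toAddSubgroup.isClosed_of_isOpen this
  exact h.completeSpace_coe

end NumberField
-- Discs of level `n` around a root, and harmonic functions on one tree
section Levels

variable {K : Type*} [Field K] {A : ValuationSubring K} [IsDiscreteValuationRing A]

namespace Edge

/-- The edges at distance `n` from the vertex `v₀` which point towards `v₀`; the sets `U_e`
attached to them are the residue discs of level `n`. -/
def level (v₀ : Vertex A) : ℕ → Set (Edge A)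
  | 0 => {e | e.tgt = v₀}
  | n + 1 => {e | ∃ e' ∈ level v₀ n, e.tgt = e'.src ∧ e ≠ e'.opp}

/-- A point of `U_f` outside `U_e` would lie in the disc of `e.opp`, which ends at the same vertex
as `f`; discs of distinct edges with the same target are disjoint. -/
theorem ends_subset_of_child {e f : Edge A} (h : f.tgt = e.src) (hne : f ≠ e.opp) :
    f.ends ⊆ e.ends := by
  intro x hx
  by_contra hxe
  rw [← Set.mem_compl_iff, ← ends_opp] at hxe
  exact hne (eq_of_mem_ends h hx hxe)

theorem exists_mem_level (v₀ : Vertex A) (n : ℕ) (x : ℙ K (Fin 2 → K)) :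
    ∃ e ∈ level v₀ n, x ∈ e.ends := by
  induction n with
  | zero => exact exists_tgt_eq_and_mem_ends v₀ x
  | succ n ih =>
    obtain ⟨e, he, hx⟩ := ih
    obtain ⟨f, hf, hxf⟩ := exists_tgt_eq_and_mem_ends e.src x
    refine ⟨f, ⟨e, he, hf, ?_⟩, hxf⟩
    rintro rfl
    rw [ends_opp] at hxf
    exact hxf hx

theorem eq_of_mem_level {v₀ : Vertex A} {n : ℕ} {e f : Edge A} (he : e ∈ level v₀ n)
    (hf : f ∈ level v₀ n) {x : ℙ K (Fin 2 → K)} (hxe : x ∈ e.ends) (hxf : x ∈ f.ends) : e = f := by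
  induction n generalizing e f with
  | zero => exact eq_of_mem_ends (Eq.trans he (Eq.symm hf)) hxe hxf
  | succ n ih =>
    obtain ⟨e', he', hte, hne⟩ := he
    obtain ⟨f', hf', htf, hnf⟩ := hf
    have := ih he' hf' (ends_subset_of_child hte hne hxe) (ends_subset_of_child htf hnf hxf)
    subst this
    exact eq_of_mem_ends (hte.trans htf.symm) hxe hxf

theorem exists_level_superset {v₀ : Vertex A} {n m : ℕ} (h : n ≤ m) {f : Edge A}
    (hf : f ∈ level v₀ m) : ∃ e ∈ level v₀ n, f.ends ⊆ e.ends := by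
  induction m, h using Nat.le_induction generalizing f with
  | base => exact ⟨f, hf, subset_rfl⟩
  | succ m _ ih =>
    obtain ⟨f', hf', ht, hne⟩ := hf
    obtain ⟨e, he, hle⟩ := ih hf'
    exact ⟨e, he, (ends_subset_of_child ht hne).trans hle⟩

/-- The ultrametric dichotomy: the level-`n` disc containing `U_f` is either `U_e` or disjoint from
it. -/
theorem subset_or_disjoint_of_mem_level {v₀ : Vertex A} {n m : ℕ} (h : n ≤ m) {e f : Edge A}
    (he : e ∈ level v₀ n) (hf : f ∈ level v₀ m) :
    f.ends ⊆ e.ends ∨ Disjoint f.ends e.ends := by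
  obtain ⟨e', he', hle⟩ := exists_level_superset h hf
  by_cases hee : e' = e
  · exact Or.inl (hee ▸ hle)
  · refine Or.inr (Set.disjoint_left.2 fun x hx hxe => hee ?_)
    exact eq_of_mem_level he' he (hle hx) hxe

/-- Up to its orientation, every edge belongs to some level. -/
theorem exists_mem_level_or_opp (v₀ : Vertex A) (e : Edge A) :
    ∃ n, e ∈ level v₀ n ∨ e.opp ∈ level v₀ n := by
  have key : ∀ v : Vertex A, v = v₀ ∨ ∃ n, ∃ f ∈ level v₀ n, v = f.src := by
    refine vertex_induction (v₀ := v₀) (Or.inl rfl) ?_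
    rintro e (he | ⟨n, f, hf, he⟩)
    · exact Or.inr ⟨0, e, he, rfl⟩
    -- Either `e` retraces `f`, and its source is the end of `f` nearer the root, or `e` is itself
    -- an edge of the next level.
    · by_cases hef : e = f.opp
      · subst hef
        change f.tgt = v₀ ∨ ∃ n, ∃ f' ∈ level v₀ n, f.tgt = f'.src
        cases n with
        | zero => exact Or.inl hf
        | succ n =>
          obtain ⟨f', hf', h, -⟩ := hf
          exact Or.inr ⟨n, f', hf', h⟩
      · exact Or.inr ⟨n + 1, e, ⟨f, hf, he, hef⟩, rfl⟩
  rcases key e.tgt with he | ⟨n, f, hf, he⟩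
  · exact ⟨0, Or.inl he⟩
  · by_cases hef : e = f.opp
    · exact ⟨n, Or.inr (hef ▸ hf)⟩
    · exact ⟨n + 1, Or.inl ⟨f, hf, he, hef⟩⟩

/-- The discs of sufficiently high level are contained in `U_e` or disjoint from it. -/
theorem exists_forall_subset_or_disjoint (v₀ : Vertex A) (e : Edge A) :
    ∃ n, ∀ m, n ≤ m → ∀ f ∈ level v₀ m, f.ends ⊆ e.ends ∨ Disjoint f.ends e.ends := by
  obtain ⟨n, hn | hn⟩ := exists_mem_level_or_opp v₀ e
  · exact ⟨n, fun m hm f hf => subset_or_disjoint_of_mem_level hm hn hf⟩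
  · refine ⟨n, fun m hm f hf => ?_⟩
    have h := subset_or_disjoint_of_mem_level hm hn hf
    rw [ends_opp, Set.disjoint_compl_right_iff_subset, Set.subset_compl_iff_disjoint_right] at h
    exact h.symm

/-- The discs of high level separate points. -/
theorem exists_level_separating (v₀ : Vertex A) {x y : ℙ K (Fin 2 → K)} (hxy : x ≠ y) :
    ∃ n, ∀ f ∈ level v₀ n, x ∈ f.ends → y ∉ f.ends := by
  obtain ⟨e, hx, hy⟩ := exists_mem_ends_notMem_ends A hxy
  obtain ⟨n, hn⟩ := exists_forall_subset_or_disjoint v₀ e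
  refine ⟨n, fun f hf hxf hyf => ?_⟩
  rcases hn n le_rfl f hf with h | h
  · exact hy (h hyf)
  · exact Set.disjoint_left.1 h hxf hx

variable [Finite (IsLocalRing.ResidueField A)]

/-- Reversal identifies the edges with source `v` with the edges with target `v`. -/
def srcEquivTgt (v : Vertex A) : {e : Edge A // e.src = v} ≃ {e : Edge A // e.tgt = v} where
  toFun e := ⟨e.1.opp, e.2⟩
  invFun e := ⟨e.1.opp, e.2⟩
  left_inv _ := rfl
  right_inv _ := rfl

theorem finite_setOf_tgt_eq (v : Vertex A) : {e : Edge A | e.tgt = v}.Finite :=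
  Set.finite_coe_iff.1 (Finite.of_equiv _ (srcEquivTgt v))

/-- The edges with target `v`. -/
noncomputable def star (v : Vertex A) : Finset (Edge A) := (finite_setOf_tgt_eq v).toFinset

theorem mem_star {v : Vertex A} {e : Edge A} : e ∈ star v ↔ e.tgt = v :=
  (finite_setOf_tgt_eq v).mem_toFinset

open Classical in
/-- The edges other than the reverse of `e` which end at the source of `e`; their discs partition
`U_e`. -/
noncomputable def children (e : Edge A) : Finset (Edge A) := (star e.src).erase e.opp

theorem mem_children {e f : Edge A} : f ∈ e.children ↔ f.tgt = e.src ∧ f ≠ e.opp := by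
  classical
  rw [children, Finset.mem_erase, mem_star, and_comm]

theorem finite_level (v₀ : Vertex A) (n : ℕ) : (level v₀ n).Finite := by
  induction n with
  | zero => exact finite_setOf_tgt_eq v₀
  | succ n ih =>
    refine (ih.biUnion fun e _ => e.children.finite_toSet).subset ?_
    rintro f ⟨e, he, h⟩
    exact Set.mem_biUnion he (mem_children.2 h)

/-- The edges of level `n`, as a `Finset`. -/
noncomputable def levelFinset (v₀ : Vertex A) (n : ℕ) : Finset (Edge A) :=
  (finite_level v₀ n).toFinset

theorem mem_levelFinset {v₀ : Vertex A} {n : ℕ} {e : Edge A} :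
    e ∈ levelFinset v₀ n ↔ e ∈ level v₀ n := (finite_level v₀ n).mem_toFinset

theorem mem_levelFinset_succ {v₀ : Vertex A} {n : ℕ} {f : Edge A} :
    f ∈ levelFinset v₀ (n + 1) ↔ ∃ e ∈ levelFinset v₀ n, f ∈ e.children := by
  simp only [mem_levelFinset, mem_children]
  rfl

theorem ends_subset_of_mem_children {e f : Edge A} (h : f ∈ e.children) : f.ends ⊆ e.ends :=
  ends_subset_of_child (mem_children.1 h).1 (mem_children.1 h).2

/-- Harmonic functions on the oriented edges of a single tree. -/
def IsHarmonic (c : Edge A → ℤ) : Prop :=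
  (∀ e, c e + c e.opp = 0) ∧ ∀ v, ∑ e ∈ star v, c e = 0

/-- Bridge between sums over outgoing edges, as in `degeneracy`, and the sums over incoming edges
used in `IsHarmonic`. -/
theorem finsum_src_eq {c : Edge A → ℤ} (hc : ∀ e, c e + c e.opp = 0) (v : Vertex A) :
    ∑ᶠ e : {e : Edge A // e.src = v}, c e.1 = -∑ e ∈ star v, c e := by
  have h1 : ∀ e : {e : Edge A // e.src = v}, c e.1 = -c (srcEquivTgt v e).1 := fun e =>
    eq_neg_of_add_eq_zero_left (hc e.1)
  rw [finsum_congr h1, finsum_comp_equiv (srcEquivTgt v) (f := fun e => -c e.1),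
    finsum_neg_distrib]
  congr 1
  rw [finsum_subtype_eq_finsum_cond fun e : Edge A => e.tgt = v,
    ← finsum_mem_finset_eq_sum]
  simp only [mem_star]

namespace IsHarmonic

variable {c : Edge A → ℤ}

/-- The edges ending at the source of `e` are its children and `e.opp`. Their total is zero, and `c
e.opp = -c e`. -/
theorem sum_children (hc : IsHarmonic c) (e : Edge A) : ∑ f ∈ e.children, c f = c e := by
  classical
  have h1 := Finset.add_sum_erase (star e.src) c (mem_star.2 (rfl : e.opp.tgt = e.src))
  rw [hc.2] at h1
  have h2 := hc.1 e
  change ∑ f ∈ (star e.src).erase e.opp, c f = _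
  linarith

/-- Level `n + 1` is the disjoint union of the families of children of level `n`, so a selection
constant on families keeps its sum. -/
theorem sum_level_succ (hc : IsHarmonic c) (v₀ : Vertex A) (n : ℕ) (p : Edge A → Prop)
    [DecidablePred p] (hp : ∀ e ∈ level v₀ n, ∀ f ∈ e.children, p f ↔ p e) :
    ∑ f ∈ levelFinset v₀ (n + 1) with p f, c f = ∑ e ∈ levelFinset v₀ n with p e, c e := by
  classical
  have h1 : ((levelFinset v₀ (n + 1)).filter p) =
      ((levelFinset v₀ n).filter p).biUnion children := by
    ext f
    simp only [Finset.mem_filter, Finset.mem_biUnion, mem_levelFinset_succ]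
    constructor
    · rintro ⟨⟨e, he, hf⟩, h⟩
      exact ⟨e, ⟨he, (hp e (mem_levelFinset.1 he) f hf).1 h⟩, hf⟩
    · rintro ⟨e, ⟨he, h⟩, hf⟩
      exact ⟨⟨e, he, hf⟩, (hp e (mem_levelFinset.1 he) f hf).2 h⟩
  rw [h1, Finset.sum_biUnion]
  · exact Finset.sum_congr rfl fun e _ => hc.sum_children e
  · intro e he e' he' hne
    refine Finset.disjoint_left.2 fun f hf hf' => hne ?_
    obtain ⟨x, hx⟩ := f.ends_nonempty
    exact eq_of_mem_level (mem_levelFinset.1 (Finset.mem_filter.1 he).1)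
      (mem_levelFinset.1 (Finset.mem_filter.1 he').1) (ends_subset_of_mem_children hf hx)
      (ends_subset_of_mem_children hf' hx)

theorem sum_level (hc : IsHarmonic c) (v₀ : Vertex A) (n : ℕ) :
    ∑ e ∈ levelFinset v₀ n, c e = 0 := by
  induction n with
  | zero =>
    rw [← hc.2 v₀]
    refine Finset.sum_congr (Finset.ext fun e => ?_) fun _ _ => rfl
    rw [mem_levelFinset, mem_star]
    rfl
  | succ n ih =>
    have := hc.sum_level_succ v₀ n (fun _ => True) fun _ _ _ _ => Iff.rfl
    simpa [ih] using this

open Classical in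
theorem sum_level_subset_of_mem (hc : IsHarmonic c) {v₀ : Vertex A} {n m : ℕ} (h : n ≤ m)
    {e : Edge A} (he : e ∈ level v₀ n) :
    ∑ f ∈ levelFinset v₀ m with f.ends ⊆ e.ends, c f = c e := by
  induction m, h using Nat.le_induction with
  | base =>
    have h1 : ((levelFinset v₀ n).filter fun f => f.ends ⊆ e.ends) = {e} := by
      ext f
      rw [Finset.mem_filter, Finset.mem_singleton, mem_levelFinset]
      constructor
      · rintro ⟨hf, hle⟩
        obtain ⟨x, hx⟩ := f.ends_nonempty
        exact eq_of_mem_level hf he hx (hle hx)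
      · rintro rfl
        exact ⟨he, subset_rfl⟩
    rw [h1, Finset.sum_singleton]
  | succ m hm ih =>
    rw [← ih]
    refine hc.sum_level_succ v₀ m _ fun g hg f hf => ⟨fun hfe => ?_, fun hge =>
      (ends_subset_of_mem_children hf).trans hge⟩
    refine (subset_or_disjoint_of_mem_level hm he hg).resolve_right fun hd => ?_
    obtain ⟨x, hx⟩ := f.ends_nonempty
    exact Set.disjoint_left.1 hd (ends_subset_of_mem_children hf hx) (hfe hx)

end IsHarmonic

open Classical in
/-- The value of a harmonic function at `e` is the sum of its values at the discs of sufficiently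
high level contained in `U_e`. -/
theorem exists_forall_sum_level_subset (v₀ : Vertex A) (e : Edge A) :
    -- The level is chosen before `c`, since it will serve all functions obtained by freezing the
    -- other components of a cochain.
    ∃ n, ∀ m, n ≤ m → ∀ c : Edge A → ℤ, IsHarmonic c →
      c e = ∑ f ∈ levelFinset v₀ m with f.ends ⊆ e.ends, c f := by
  obtain ⟨n, hn | hn⟩ := exists_mem_level_or_opp v₀ e
  · exact ⟨n, fun m hm c hc => (hc.sum_level_subset_of_mem hm hn).symm⟩
  -- When `e` points away from the root, the discs inside `U_e` are those not inside the disc of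
  -- `e.opp`. The whole level sums to zero, so they sum to `-c e.opp = c e`.
  · refine ⟨n, fun m hm c hc => ?_⟩
    have h1 := hc.sum_level_subset_of_mem hm hn
    have h2 := Finset.sum_filter_add_sum_filter_not (levelFinset v₀ m)
      (fun f => f.ends ⊆ e.opp.ends) c
    have h3 : ((levelFinset v₀ m).filter fun f => ¬ f.ends ⊆ e.opp.ends) =
        (levelFinset v₀ m).filter fun f => f.ends ⊆ e.ends := by
      refine Finset.filter_congr fun f hf => ?_
      obtain ⟨x, hx⟩ := f.ends_nonempty
      have h4 := subset_or_disjoint_of_mem_level hm hn (mem_levelFinset.1 hf)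
      rw [ends_opp, Set.disjoint_compl_right_iff_subset] at h4
      rw [ends_opp]
      exact ⟨fun h => h4.resolve_left h, fun h h' => h' hx (h hx)⟩
    rw [h1, h3, hc.sum_level] at h2
    have h5 := hc.1 e
    linarith

end Edge

end Levels
open TopologicalSpace

/-! ### Summation one component at a time -/

section Update

variable {ι M : Type*} {E : ι → Type*} [AddCommMonoid M]

open Classical in
/-- Summation over the component at `i`, for a set which is a product in that component. -/
theorem sum_eq_sum_sum_update (c : (∀ i, E i) → M) (i : ι) (a : E i) (D : Finset (E i))
    (s s' : Finset (∀ i, E i)) (hs' : ∀ g ∈ s', g i = a)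
    (hs : ∀ f, f ∈ s ↔ f i ∈ D ∧ Function.update f i a ∈ s') :
    ∑ f ∈ s, c f = ∑ g ∈ s', ∑ d ∈ D, c (Function.update g i d) := by
  rw [← Finset.sum_product']
  refine Finset.sum_nbij' (fun f => (Function.update f i a, f i))
    (fun p => Function.update p.1 i p.2) ?_ ?_ ?_ ?_ ?_
  · intro f hf
    rw [Finset.mem_product]
    exact ((hs f).1 hf).symm
  · rintro ⟨g, d⟩ h
    rw [Finset.mem_product] at h
    rw [hs, Function.update_self, Function.update_idem, ← hs' g h.1, Function.update_eq_self]
    exact h.symm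
  · intro f _
    simp
  · rintro ⟨g, d⟩ h
    rw [Finset.mem_product] at h
    simp only [Function.update_idem, Function.update_self]
    rw [← hs' g h.1, Function.update_eq_self]
  · intro f _
    simp

open Classical in
/-- If the value at `e` may be computed by summing in every single component, then it may be
computed by summing in all components. -/
theorem eq_sum_piFinset [Fintype ι] (c : (∀ i, E i) → M) (e : ∀ i, E i) (D : ∀ i, Finset (E i))
    (h : ∀ i f, f i = e i → c f = ∑ d ∈ D i, c (Function.update f i d)) :
    c e = ∑ f ∈ Fintype.piFinset D, c f := by
  -- The components in `s` have been expanded into `D i` and the others are still frozen at `e i`,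
  -- where `h` applies; `s` grows by one component at a time.
  have key : ∀ s : Finset ι,
      c e = ∑ f ∈ Fintype.piFinset (fun i => if i ∈ s then D i else {e i}), c f := by
    intro s
    induction s using Finset.induction_on with
    | empty => simp
    | insert j s hj ih =>
      rw [ih]
      have hmem : ∀ g ∈ Fintype.piFinset (fun i => if i ∈ s then D i else {e i}), g j = e j := by
        intro g hg
        have := Fintype.mem_piFinset.1 hg j
        rwa [if_neg hj, Finset.mem_singleton] at this
      rw [sum_eq_sum_sum_update c j (e j) (D j)
        (Fintype.piFinset fun i => if i ∈ insert j s then D i else {e i}) _ hmem]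
      · exact Finset.sum_congr rfl fun g hg => h j g (hmem g hg)
      · intro f
        rw [Fintype.mem_piFinset, Fintype.mem_piFinset]
        constructor
        · intro hf
          refine ⟨by simpa using hf j, fun i => ?_⟩
          by_cases hij : i = j
          · subst hij; simp [hj]
          · simpa [hij] using hf i
        · rintro ⟨h1, h2⟩ i
          by_cases hij : i = j
          · subst hij; simpa using h1
          · simpa [hij] using h2 i
  simpa using key Finset.univ

end Update

/-! ### Finitely additive functions on finite disjoint unions -/

section FinitelyAdditive

variable {X : Type*} [TopologicalSpace X]

theorem coe_finset_sup_compactOpens {α : Type*} (s : Finset α) (U : α → CompactOpens X) :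
    ((s.sup U : CompactOpens X) : Set X) = ⋃ a ∈ s, (U a : Set X) := by
  classical
  induction s using Finset.induction_on with
  | empty => simp
  | insert a s ha ih => rw [Finset.sup_insert, CompactOpens.coe_sup, ih, Finset.set_biUnion_insert]

theorem finAddMeasure_bot {μ : CompactOpens X → ℤ} (hμ : μ ∈ finAddMeasure X) : μ ⊥ = 0 := by
  have := hμ ⊥ ⊥ (by simp)
  simpa using this

theorem finAddMeasure_sup {α : Type*} {μ : CompactOpens X → ℤ} (hμ : μ ∈ finAddMeasure X)
    (s : Finset α) (U : α → CompactOpens X)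
    (hd : ∀ a ∈ s, ∀ b ∈ s, a ≠ b → Disjoint (U a : Set X) (U b)) :
    μ (s.sup U) = ∑ a ∈ s, μ (U a) := by
  classical
  induction s using Finset.induction_on with
  | empty => simpa using finAddMeasure_bot hμ
  | insert a s ha ih =>
    rw [Finset.sup_insert, Finset.sum_insert ha, hμ, ih]
    · exact fun b hb b' hb' => hd b (Finset.mem_insert_of_mem hb) b' (Finset.mem_insert_of_mem hb')
    · rw [coe_finset_sup_compactOpens]
      simp only [Set.disjoint_iUnion_right]
      intro b hb
      refine hd a (Finset.mem_insert_self a s) b (Finset.mem_insert_of_mem hb) ?_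
      rintro rfl
      exact ha hb

end FinitelyAdditive

/-! ### Boxes: products of discs -/

section Boxes

variable {ι : Type*} {K : ι → Type*} [∀ i, Field (K i)] {A : ∀ i, ValuationSubring (K i)}

namespace MultiEdge

theorem ends_nonempty (e : MultiEdge A) : e.ends.Nonempty := by
  choose x hx using fun i => (e i).ends_nonempty
  exact ⟨x, hx⟩

theorem ends_subset_iff {e f : MultiEdge A} : f.ends ⊆ e.ends ↔ ∀ i, (f i).ends ⊆ (e i).ends := by
  classical
  constructor
  · intro h i y hy
    obtain ⟨x, hx⟩ := f.ends_nonempty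
    have h1 : Function.update x i y ∈ f.ends := by
      intro j
      by_cases hij : j = i
      · subst hij; simpa using hy
      · simpa [hij] using hx j
    simpa using h h1 i
  · exact fun h x hx i => h i (hx i)

theorem mem_ends_replace {e : MultiEdge A} {i : ι} {e' : Edge (A i)} {x : P1S K} :
    x ∈ (e.replace i e').ends ↔ x i ∈ e'.ends ∧ ∀ j, j ≠ i → x j ∈ (e j).ends := by
  classical
  constructor
  · intro h
    refine ⟨by simpa [replace] using h i, fun j hj => by simpa [replace, hj] using h j⟩
  · rintro ⟨h1, h2⟩ j
    by_cases hij : j = i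
    · subst hij; simpa [replace] using h1
    · simpa [replace, hij] using h2 j hij

theorem smul_ends (g : PGLS K) (e : MultiEdge A) : (g • e).ends = g • e.ends := by
  ext x
  rw [Set.mem_smul_set_iff_inv_smul_mem]
  refine forall_congr' fun i => ?_
  change x i ∈ (g i • e i).ends ↔ (g i)⁻¹ • x i ∈ (e i).ends
  rw [Edge.smul_ends, Set.mem_smul_set_iff_inv_smul_mem]

theorem replace_replace (e : MultiEdge A) (i : ι) (d d' : Edge (A i)) :
    (e.replace i d).replace i d' = e.replace i d' := by
  simp [replace]

theorem replace_self (e : MultiEdge A) (i : ι) : e.replace i (e i) = e := by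
  simp [replace]

theorem replace_apply_self (e : MultiEdge A) (i : ι) (d : Edge (A i)) : e.replace i d i = d := by
  simp [replace]

variable [∀ i, IsDiscreteValuationRing (A i)] [Fintype ι]
  [∀ i, Finite (IsLocalRing.ResidueField (A i))]

/-- The boxes of level `n`. -/
noncomputable def levels (v₀ : ∀ i, Vertex (A i)) (n : ℕ) : Finset (MultiEdge A) :=
  open Classical in Fintype.piFinset fun i => Edge.levelFinset (v₀ i) n

variable {v₀ : ∀ i, Vertex (A i)}

theorem mem_levels {n : ℕ} {e : MultiEdge A} :
    e ∈ levels v₀ n ↔ ∀ i, e i ∈ Edge.level (v₀ i) n := by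
  classical
  rw [levels, Fintype.mem_piFinset]
  exact forall_congr' fun i => Edge.mem_levelFinset

theorem exists_mem_levels (v₀ : ∀ i, Vertex (A i)) (n : ℕ) (x : P1S K) :
    ∃ e ∈ levels v₀ n, x ∈ e.ends := by
  choose e he hx using fun i => Edge.exists_mem_level (v₀ i) n (x i)
  exact ⟨e, mem_levels.2 he, hx⟩

theorem eq_of_mem_levels {n : ℕ} {e f : MultiEdge A} (he : e ∈ levels v₀ n) (hf : f ∈ levels v₀ n)
    {x : P1S K} (hxe : x ∈ e.ends) (hxf : x ∈ f.ends) : e = f :=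
  funext fun i => Edge.eq_of_mem_level (mem_levels.1 he i) (mem_levels.1 hf i) (hxe i) (hxf i)

theorem exists_levels_superset {n m : ℕ} (h : n ≤ m) {f : MultiEdge A} (hf : f ∈ levels v₀ m) :
    ∃ e ∈ levels v₀ n, f.ends ⊆ e.ends := by
  choose e he hx using fun i => Edge.exists_level_superset h (mem_levels.1 hf i)
  exact ⟨e, mem_levels.2 he, ends_subset_iff.2 hx⟩

/-- `U` is a union of boxes of level `n`. -/
def Saturated (v₀ : ∀ i, Vertex (A i)) (n : ℕ) (U : Set (P1S K)) : Prop :=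
  ∀ f ∈ levels v₀ n, f.ends ⊆ U ∨ Disjoint f.ends U

theorem Saturated.mono {n m : ℕ} {U : Set (P1S K)} (hU : Saturated v₀ n U) (h : n ≤ m) :
    Saturated v₀ m U := by
  intro f hf
  obtain ⟨e, he, hle⟩ := exists_levels_superset h hf
  exact (hU e he).imp hle.trans fun h => h.mono_left hle

theorem Saturated.subset_of_mem {n : ℕ} {U : Set (P1S K)} (hU : Saturated v₀ n U)
    {f : MultiEdge A} (hf : f ∈ levels v₀ n) {x : P1S K} (hx : x ∈ f.ends) (hxU : x ∈ U) :
    f.ends ⊆ U :=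
  (hU f hf).resolve_right fun h => Set.disjoint_left.1 h hx hxU

section Topology

variable [∀ i, TopologicalSpace (K i)] [∀ i, IsTopologicalRing (K i)]

omit [∀ i, Finite (IsLocalRing.ResidueField (A i))] in
theorem isClopen_ends (hA : ∀ i, IsOpen (A i : Set (K i))) (e : MultiEdge A) : IsClopen e.ends := by
  have h : e.ends = ⋂ i, (fun x : P1S K => x i) ⁻¹' (e i).ends := by
    ext x
    rw [Set.mem_iInter]
    rfl
  rw [h]
  exact isClopen_iInter_of_finite fun i => ((e i).isClopen_ends (hA i)).preimage (continuous_apply i)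

variable [∀ i, CompactSpace (A i)]

omit [∀ i, Finite (IsLocalRing.ResidueField (A i))] in
theorem isCompact_ends (hA : ∀ i, IsOpen (A i : Set (K i))) (e : MultiEdge A) :
    IsCompact e.ends := by
  have := fun i => compactSpace_projectivization (hA i)
  exact (e.isClopen_ends hA).isClosed.isCompact

omit [∀ i, Finite (IsLocalRing.ResidueField (A i))] in
/-- The compact open set `U_e`. -/
def compactOpens (hA : ∀ i, IsOpen (A i : Set (K i))) (e : MultiEdge A) : CompactOpens (P1S K) :=
  ⟨⟨e.ends, e.isCompact_ends hA⟩, (e.isClopen_ends hA).isOpen⟩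

omit [∀ i, Finite (IsLocalRing.ResidueField (A i))] in
theorem coe_compactOpens (hA : ∀ i, IsOpen (A i : Set (K i))) (e : MultiEdge A) :
    (e.compactOpens hA : Set (P1S K)) = e.ends := rfl

/-- Every compact open set is a union of boxes of a sufficiently high level. -/
theorem exists_saturated (hA : ∀ i, IsOpen (A i : Set (K i))) (v₀ : ∀ i, Vertex (A i))
    (U : CompactOpens (P1S K)) : ∃ n, Saturated v₀ n (U : Set (P1S K)) := by
  have := fun i => compactSpace_projectivization (hA i)
  have := fun i => t2Space_projectivization (hA i)
  -- `C n` consists of the pairs in a common box of level `n` with first point in `U` and second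
  -- outside. If no level saturates `U`, these form a decreasing sequence of nonempty compact sets,
  -- and a common element gives two distinct points that no level separates.
  let C : ℕ → Set (P1S K × P1S K) := fun n =>
    ((U : Set (P1S K)) ×ˢ (U : Set (P1S K))ᶜ) ∩ ⋃ f ∈ levels v₀ n, f.ends ×ˢ f.ends
  have hclosed : ∀ n, IsClosed (C n) := fun n =>
    (U.isCompact.isClosed.prod U.isOpen.isClosed_compl).inter
      (isClosed_biUnion_finset fun f _ =>
        (f.isClopen_ends hA).isClosed.prod (f.isClopen_ends hA).isClosed)
  by_contra! hU
  have hne : ∀ n, (C n).Nonempty := by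
    intro n
    have := hU n
    unfold Saturated at this
    push Not at this
    obtain ⟨f, hf, h1, h2⟩ := this
    obtain ⟨y, hy, hyU⟩ := Set.not_subset.1 h1
    obtain ⟨x, hx, hxU⟩ := Set.not_disjoint_iff.1 h2
    exact ⟨(x, y), ⟨hxU, hyU⟩, Set.mem_biUnion hf ⟨hx, hy⟩⟩
  have hanti : ∀ n, C (n + 1) ⊆ C n := by
    rintro n ⟨x, y⟩ ⟨h1, h2⟩
    obtain ⟨f, hf, hx, hy⟩ := Set.mem_iUnion₂.1 h2
    obtain ⟨e, he, hle⟩ := exists_levels_superset n.le_succ hf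
    exact ⟨h1, Set.mem_biUnion he ⟨hle hx, hle hy⟩⟩
  obtain ⟨⟨x, y⟩, hxy⟩ := IsCompact.nonempty_iInter_of_sequence_nonempty_isCompact_isClosed C hanti
    hne (hclosed 0).isCompact hclosed
  rw [Set.mem_iInter] at hxy
  have hx : x ∈ (U : Set (P1S K)) := (hxy 0).1.1
  have hy : y ∉ (U : Set (P1S K)) := (hxy 0).1.2
  have hne' : x ≠ y := by rintro rfl; exact hy hx
  obtain ⟨i, hi⟩ := Function.ne_iff.1 hne'
  obtain ⟨n, hn⟩ := Edge.exists_level_separating (v₀ i) hi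
  obtain ⟨f, hf, hxf, hyf⟩ := Set.mem_iUnion₂.1 (hxy n).2
  exact hn (f i) (mem_levels.1 hf i) (hxf i) (hyf i)

end Topology

end MultiEdge

end Boxes
-- Passage between cochains and measures
section CochainMeasure

variable {ι : Type*} {K : ι → Type*} [∀ i, Field (K i)] {A : ∀ i, ValuationSubring (K i)}
  [∀ i, IsDiscreteValuationRing (A i)] [∀ i, Finite (IsLocalRing.ResidueField (A i))]

/-- A cochain is harmonic exactly when it is harmonic in each variable with the others frozen, which
reduces the product to single trees. -/
theorem mem_HC_iff (c : MultiEdge A → ℤ) :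
    c ∈ HC A ↔ ∀ i e, Edge.IsHarmonic fun d => c (MultiEdge.replace e i d) := by
  constructor
  · rintro ⟨h1, h2⟩ i e
    have hflip : ∀ d, c (MultiEdge.replace e i d) + c (MultiEdge.replace e i d.opp) = 0 := by
      intro d
      have := h1 i (MultiEdge.replace e i d)
      rwa [MultiEdge.flip, MultiEdge.replace_apply_self, MultiEdge.replace_replace] at this
    refine ⟨hflip, fun v => ?_⟩
    have h3 := h2 i v e
    unfold degeneracy at h3
    rw [Edge.finsum_src_eq hflip] at h3
    exact neg_eq_zero.1 h3
  · intro h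
    refine ⟨fun i e => ?_, fun i v e => ?_⟩
    · have := (h i e).1 (e i)
      simp only [MultiEdge.replace_self] at this
      exact this
    · unfold degeneracy
      rw [Edge.finsum_src_eq (h i e).1, (h i e).2, neg_zero]

variable [Fintype ι] {v₀ : ∀ i, Vertex (A i)}

open Classical in
/-- The sum of `c` over the boxes of level `n` contained in `U`. -/
noncomputable def levelSum (v₀ : ∀ i, Vertex (A i)) (c : MultiEdge A → ℤ) (n : ℕ)
    (U : Set (P1S K)) : ℤ :=
  ∑ f ∈ MultiEdge.levels v₀ n with f.ends ⊆ U, c f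

-- The boxes of level `n + 1` in a saturated `U` are grouped by their parent box. Within a group,
-- applying `sum_children` in each component returns the value at the parent.
open Classical in
theorem levelSum_succ {c : MultiEdge A → ℤ} (hc : c ∈ HC A) {n : ℕ} {U : Set (P1S K)}
    (hU : MultiEdge.Saturated v₀ n U) : levelSum v₀ c (n + 1) U = levelSum v₀ c n U := by
  have hchild : ∀ {e f : MultiEdge A}, f ∈ Fintype.piFinset (fun i => (e i).children) →
      f.ends ⊆ e.ends := fun hf => MultiEdge.ends_subset_iff.2 fun i =>
    Edge.ends_subset_of_mem_children (Fintype.mem_piFinset.1 hf i)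
  have h1 : ((MultiEdge.levels v₀ (n + 1)).filter fun f => f.ends ⊆ U) =
      ((MultiEdge.levels v₀ n).filter fun f => f.ends ⊆ U).biUnion
        fun e => Fintype.piFinset fun i => (e i).children := by
    ext f
    simp only [Finset.mem_filter, Finset.mem_biUnion]
    constructor
    · rintro ⟨hf, hfU⟩
      choose e he hfe using fun i =>
        Edge.mem_levelFinset_succ.1 (Edge.mem_levelFinset.2 (MultiEdge.mem_levels.1 hf i))
      have he' : e ∈ MultiEdge.levels v₀ n :=
        MultiEdge.mem_levels.2 fun i => Edge.mem_levelFinset.1 (he i)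
      have hfe' := Fintype.mem_piFinset.2 hfe
      obtain ⟨x, hx⟩ := f.ends_nonempty
      exact ⟨e, ⟨he', hU.subset_of_mem he' (hchild hfe' hx) (hfU hx)⟩, hfe'⟩
    · rintro ⟨e, ⟨he, heU⟩, hfe⟩
      exact ⟨MultiEdge.mem_levels.2 fun i => Edge.mem_levelFinset.1 <| Edge.mem_levelFinset_succ.2
        ⟨e i, Edge.mem_levelFinset.2 (MultiEdge.mem_levels.1 he i), Fintype.mem_piFinset.1 hfe i⟩,
        (hchild hfe).trans heU⟩
  unfold levelSum
  rw [h1, Finset.sum_biUnion]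
  · refine Finset.sum_congr rfl fun e _ => ?_
    refine (eq_sum_piFinset c e _ fun i f hfi => ?_).symm
    have := ((mem_HC_iff c).1 hc i f).sum_children (e i)
    rw [← hfi, MultiEdge.replace_self] at this
    rw [← hfi]
    exact this.symm
  · intro e he e' he' hne
    refine Finset.disjoint_left.2 fun f hf hf' => hne ?_
    obtain ⟨x, hx⟩ := MultiEdge.ends_nonempty f
    exact MultiEdge.eq_of_mem_levels (Finset.mem_filter.1 he).1 (Finset.mem_filter.1 he').1
      (hchild hf hx) (hchild hf' hx)

theorem levelSum_eq {c : MultiEdge A → ℤ} (hc : c ∈ HC A) {n m : ℕ} {U : Set (P1S K)}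
    (hU : MultiEdge.Saturated v₀ n U) (h : n ≤ m) : levelSum v₀ c m U = levelSum v₀ c n U := by
  induction m, h using Nat.le_induction with
  | base => rfl
  | succ m hm ih => rw [levelSum_succ hc (hU.mono hm), ih]

-- Box sums return the cochain at every multiedge, whichever way its components are oriented
-- relative to the roots; the maximum of the levels needed componentwise suffices.
open Classical in
theorem exists_forall_levelSum_ends (v₀ : ∀ i, Vertex (A i)) (e : MultiEdge A) :
    ∃ n, ∀ m, n ≤ m → ∀ c ∈ HC A, levelSum v₀ c m e.ends = c e := by
  choose n hn using fun i => Edge.exists_forall_sum_level_subset (v₀ i) (e i)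
  refine ⟨Finset.univ.sup n, fun m hm c hc => ?_⟩
  have h1 : ((MultiEdge.levels v₀ m).filter fun f => f.ends ⊆ e.ends) =
      Fintype.piFinset fun i => (Edge.levelFinset (v₀ i) m).filter fun d => d.ends ⊆ (e i).ends := by
    ext f
    simp only [Finset.mem_filter, Fintype.mem_piFinset, MultiEdge.mem_levels, Edge.mem_levelFinset,
      MultiEdge.ends_subset_iff, forall_and]
  unfold levelSum
  rw [h1]
  refine (eq_sum_piFinset c e _ fun i f hfi => ?_).symm
  have := hn i m ((Finset.le_sup (Finset.mem_univ i)).trans hm) _ ((mem_HC_iff c).1 hc i f)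
  rw [← hfi, MultiEdge.replace_self] at this
  rw [← hfi]
  exact this

theorem levelSum_add (c : MultiEdge A → ℤ) {n : ℕ} {U V : Set (P1S K)}
    (hU : MultiEdge.Saturated v₀ n U) (hV : MultiEdge.Saturated v₀ n V) (h : Disjoint U V) :
    levelSum v₀ c n (U ∪ V) = levelSum v₀ c n U + levelSum v₀ c n V := by
  classical
  unfold levelSum
  rw [← Finset.sum_union]
  · refine Finset.sum_congr ?_ fun _ _ => rfl
    ext f
    simp only [Finset.mem_filter, Finset.mem_union, ← and_or_left]
    refine and_congr_right fun hf => ⟨fun hle => ?_, ?_⟩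
    · obtain ⟨x, hx⟩ := f.ends_nonempty
      exact (hle hx).imp (hU.subset_of_mem hf hx) (hV.subset_of_mem hf hx)
    · rintro (hle | hle)
      · exact hle.trans Set.subset_union_left
      · exact hle.trans Set.subset_union_right
  · refine Finset.disjoint_left.2 fun f hf hf' => ?_
    obtain ⟨x, hx⟩ := f.ends_nonempty
    exact Set.disjoint_left.1 h ((Finset.mem_filter.1 hf).2 hx) ((Finset.mem_filter.1 hf').2 hx)

open Classical in
/-- The sum vanishes if `U` does not depend on the component at `i`. -/
theorem levelSum_cylinder {c : MultiEdge A → ℤ} (hc : c ∈ HC A) (n : ℕ) (i : ι)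
    (V : Set (P1S fun j : {j // j ≠ i} => K j)) :
    levelSum v₀ c n {x | (fun j : {j // j ≠ i} => x j) ∈ V} = 0 := by
  set U : Set (P1S K) := {x | (fun j : {j // j ≠ i} => x j) ∈ V} with hUdef
  have hU : ∀ x y : P1S K, (∀ j, j ≠ i → x j = y j) → (x ∈ U ↔ y ∈ U) := by
    intro x y h
    have : (fun j : {j // j ≠ i} => x j) = fun j : {j // j ≠ i} => y j :=
      funext fun j => h j j.2
    change (fun j : {j // j ≠ i} => x j) ∈ V ↔ (fun j : {j // j ≠ i} => y j) ∈ V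
    rw [this]
  have hup : ∀ (f : MultiEdge A) (d d' : Edge (A i)), (f.replace i d).ends ⊆ U →
      (f.replace i d').ends ⊆ U := by
    intro f d d' h x hx
    obtain ⟨y, hy⟩ := d.ends_nonempty
    rw [MultiEdge.mem_ends_replace] at hx
    refine (hU (Function.update x i y) x fun j hj => by simp [hj]).1 (h ?_)
    rw [MultiEdge.mem_ends_replace]
    exact ⟨by simpa using hy, fun j hj => by simpa [hj] using hx.2 j hj⟩
  obtain ⟨x₀⟩ : Nonempty (P1S K) := ⟨fun i => Projectivization.mk (K i) ![1, 0] (by simp)⟩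
  -- Only `a i` matters: it is an arbitrary level-`n` edge that normalises the component at `i`. The
  -- boxes in `U` then fall into groups in which this component runs over the entire level, and each
  -- group sums to zero.
  obtain ⟨a, ha, -⟩ := MultiEdge.exists_mem_levels v₀ n x₀
  have ha' := MultiEdge.mem_levels.1 ha i
  unfold levelSum
  rw [sum_eq_sum_sum_update c i (a i) (Edge.levelFinset (v₀ i) n) _
    (((MultiEdge.levels v₀ n).filter fun f => f.ends ⊆ U).filter fun f => f i = a i)
    fun g hg => (Finset.mem_filter.1 hg).2]
  · exact Finset.sum_eq_zero fun g _ => ((mem_HC_iff c).1 hc i g).sum_level (v₀ i) n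
  · intro f
    simp only [Finset.mem_filter, MultiEdge.mem_levels, Edge.mem_levelFinset, Function.update_self,
      and_true]
    constructor
    · rintro ⟨hf, hfU⟩
      refine ⟨hf i, fun j => ?_, hup f (f i) (a i) (by rwa [MultiEdge.replace_self])⟩
      by_cases hj : j = i
      · subst hj; simpa using ha'
      · simpa [hj] using hf j
    · rintro ⟨hi, hf, hfU⟩
      refine ⟨fun j => ?_, ?_⟩
      · by_cases hj : j = i
        · subst hj; exact hi
        · simpa [hj] using hf j
      · have := hup f (a i) (f i) hfU
        rwa [MultiEdge.replace_self] at this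

variable [∀ i, TopologicalSpace (K i)] [∀ i, IsTopologicalRing (K i)] [∀ i, CompactSpace (A i)]

variable (hA : ∀ i, IsOpen (A i : Set (K i)))
include hA

/-- A finitely additive function is determined by its values on the sets `U_e`. -/
theorem finAddMeasure_eq_levelSum {μ : CompactOpens (P1S K) → ℤ}
    (hμ : μ ∈ finAddMeasure (P1S K)) {n : ℕ} {U : CompactOpens (P1S K)}
    (hU : MultiEdge.Saturated v₀ n (U : Set (P1S K))) :
    μ U = levelSum v₀ (fun e => μ (e.compactOpens hA)) n U := by
  classical
  have h1 : U = ((MultiEdge.levels v₀ n).filter fun f => f.ends ⊆ (U : Set (P1S K))).sup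
      fun e => e.compactOpens hA := by
    refine CompactOpens.ext ?_
    rw [coe_finset_sup_compactOpens]
    ext x
    simp only [Set.mem_iUnion, Finset.mem_filter, MultiEdge.coe_compactOpens]
    constructor
    · intro hx
      obtain ⟨f, hf, hxf⟩ := MultiEdge.exists_mem_levels v₀ n x
      exact ⟨f, ⟨hf, hU.subset_of_mem hf hxf hx⟩, hxf⟩
    · rintro ⟨f, ⟨-, hf⟩, hxf⟩
      exact hf hxf
  conv_lhs => rw [h1]
  refine finAddMeasure_sup hμ _ _ fun e he f hf hne => Set.disjoint_left.2 fun x hx hx' => hne ?_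
  exact MultiEdge.eq_of_mem_levels (Finset.mem_filter.1 he).1 (Finset.mem_filter.1 hf).1 hx hx'

theorem finAddMeasure_ext {μ ν : CompactOpens (P1S K) → ℤ} (hμ : μ ∈ finAddMeasure (P1S K))
    (hν : ν ∈ finAddMeasure (P1S K))
    (h : ∀ e : MultiEdge A, μ (e.compactOpens hA) = ν (e.compactOpens hA)) : μ = ν := by
  funext U
  let v₀ : ∀ i, Vertex (A i) := fun i => Vertex.mk (Lat.ofBasis (A i) (Pi.basisFun (K i) (Fin 2)))
  obtain ⟨n, hn⟩ := MultiEdge.exists_saturated hA v₀ U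
  rw [finAddMeasure_eq_levelSum hA hμ hn, finAddMeasure_eq_levelSum hA hν hn]
  simp only [h]

/-- Every harmonic cochain comes from a measure. -/
theorem exists_measure_of_mem_HC {c : MultiEdge A → ℤ} (hc : c ∈ HC A) :
    ∃ μ ∈ plecticMeasure K, ∀ e : MultiEdge A, μ (e.compactOpens hA) = c e := by
  let v₀ : ∀ i, Vertex (A i) := fun i => Vertex.mk (Lat.ofBasis (A i) (Pi.basisFun (K i) (Fin 2)))
  choose N hN using MultiEdge.exists_saturated hA v₀
  -- The chosen level `N U` is irrelevant to the value, so several sets can be compared at one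
  -- common level.
  have key : ∀ (U : CompactOpens (P1S K)) (n : ℕ), N U ≤ n →
      levelSum v₀ c (N U) U = levelSum v₀ c n U := fun U n hn => (levelSum_eq hc (hN U) hn).symm
  refine ⟨fun U => levelSum v₀ c (N U) U, ⟨fun U V h => ?_, fun i V U h => ?_⟩, fun e => ?_⟩
  · let n := max (N (U ⊔ V)) (max (N U) (N V))
    have hU : N U ≤ n := (le_max_left _ _).trans (le_max_right _ _)
    have hV : N V ≤ n := (le_max_right _ _).trans (le_max_right _ _)
    change levelSum v₀ c _ _ = levelSum v₀ c _ _ + levelSum v₀ c _ _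
    rw [key U n hU, key V n hV, key (U ⊔ V) n (le_max_left _ _), CompactOpens.coe_sup]
    exact levelSum_add c ((hN U).mono hU) ((hN V).mono hV) h
  · change levelSum v₀ c (N U) U = 0
    rw [h]
    exact levelSum_cylinder hc _ i V
  · obtain ⟨n, hn⟩ := exists_forall_levelSum_ends v₀ e
    change levelSum v₀ c _ _ = _
    rw [key _ (max (N (e.compactOpens hA)) n) (le_max_left _ _)]
    exact hn _ (le_max_right _ _) c hc

/-- The values of a measure on the sets `U_e` form a harmonic cochain. -/
theorem mem_HC_of_mem_plecticMeasure {μ : CompactOpens (P1S K) → ℤ} (hμ : μ ∈ plecticMeasure K) :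
    (fun e : MultiEdge A => μ (e.compactOpens hA)) ∈ HC A := by
  classical
  rw [mem_HC_iff]
  intro i e
  -- If the discs of `s` partition the projective line at `i`, the corresponding boxes have as union
  -- a cylinder, on which `μ` vanishes. The partitions used are `{d, d.opp}` and the star of a
  -- vertex.
  have key : ∀ s : Finset (Edge (A i)), (∀ y, ∃ d ∈ s, y ∈ d.ends) →
      (∀ d ∈ s, ∀ d' ∈ s, d ≠ d' → Disjoint d.ends d'.ends) →
      ∑ d ∈ s, μ ((e.replace i d).compactOpens hA) = 0 := by
    intro s hcov hdisj
    rw [← finAddMeasure_sup hμ.1]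
    · refine hμ.2 i (MultiEdge.compactOpens (A := fun j : {j // j ≠ i} => A j) (fun j => hA j)
        fun j => e j) _ ?_
      rw [coe_finset_sup_compactOpens]
      ext x
      simp only [Set.mem_iUnion, MultiEdge.coe_compactOpens, MultiEdge.mem_ends_replace]
      constructor
      · rintro ⟨d, hd, -, hx⟩ j
        exact hx j j.2
      · intro hx
        obtain ⟨d, hd, hxd⟩ := hcov (x i)
        exact ⟨d, hd, hxd, fun j hj => hx ⟨j, hj⟩⟩
    · intro d hd d' hd' hne
      refine Set.disjoint_left.2 fun x hx hx' => ?_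
      exact Set.disjoint_left.1 (hdisj d hd d' hd' hne) (MultiEdge.mem_ends_replace.1 hx).1
        (MultiEdge.mem_ends_replace.1 hx').1
  refine ⟨fun d => ?_, fun v => ?_⟩
  · have hdd : Disjoint d.ends d.opp.ends := by rw [Edge.ends_opp]; exact disjoint_compl_right
    have hne : d ≠ d.opp := by
      intro h
      rw [← h, disjoint_self] at hdd
      exact d.ends_nonempty.ne_empty hdd
    rw [← Finset.sum_pair (f := fun d => μ ((e.replace i d).compactOpens hA)) hne]
    refine key _ (fun y => ?_) ?_
    · by_cases hy : y ∈ d.ends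
      · exact ⟨d, by simp, hy⟩
      · exact ⟨d.opp, by simp, by rw [Edge.ends_opp]; exact hy⟩
    · intro a ha b hb hab
      simp only [Finset.mem_insert, Finset.mem_singleton] at ha hb
      rcases ha with rfl | rfl <;> rcases hb with rfl | rfl
      · exact (hab rfl).elim
      · exact hdd
      · exact hdd.symm
      · exact (hab rfl).elim
  · refine key _ (fun y => ?_) fun d hd d' hd' hne => Set.disjoint_left.2 fun y hy hy' => hne ?_
    · obtain ⟨d, hd, hy⟩ := Edge.exists_tgt_eq_and_mem_ends v y
      exact ⟨d, Edge.mem_star.2 hd, hy⟩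
    · exact Edge.eq_of_mem_ends ((Edge.mem_star.1 hd).trans (Edge.mem_star.1 hd').symm) hy hy'

/-- Evaluation of measures on the sets `U_e`. -/
noncomputable def evalEnds : plecticMeasure K →+ HC A where
  toFun μ := ⟨fun e => μ.1 (e.compactOpens hA), mem_HC_of_mem_plecticMeasure hA μ.2⟩
  map_zero' := rfl
  map_add' _ _ := rfl

theorem evalEnds_bijective : Function.Bijective (evalEnds (A := A) hA) := by
  constructor
  · intro μ ν h
    exact Subtype.ext (finAddMeasure_ext hA μ.2.1 ν.2.1 fun e => congrFun (congrArg Subtype.val h) e)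
  · rintro ⟨c, hc⟩
    obtain ⟨μ, hμ, h⟩ := exists_measure_of_mem_HC hA hc
    exact ⟨⟨μ, hμ⟩, Subtype.ext (funext h)⟩

/-- The isomorphism between harmonic cochains and measures. -/
noncomputable def cochainEquivMeasure : HC A ≃+ plecticMeasure K :=
  (AddEquiv.ofBijective (evalEnds hA) (evalEnds_bijective hA)).symm

theorem cochainEquivMeasure_apply (c : HC A) (e : MultiEdge A) :
    (cochainEquivMeasure hA c).1 (e.compactOpens hA) = c.1 e :=
  congrFun (congrArg Subtype.val
    ((AddEquiv.ofBijective (evalEnds hA) (evalEnds_bijective hA)).apply_symm_apply c)) e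

/-- Both sides are finitely additive, so it suffices to compare them on boxes, where translation of
sets matches translation of multiedges. -/
theorem cochainEquivMeasure_smul (g : PGLS K) (c : HC A) :
    cochainEquivMeasure hA (g • c) = g • cochainEquivMeasure hA c := by
  refine Subtype.ext (finAddMeasure_ext hA (cochainEquivMeasure hA (g • c)).2.1
    (g • cochainEquivMeasure hA c).2.1 fun e => ?_)
  have h1 : g⁻¹ • e.compactOpens hA = (g⁻¹ • e).compactOpens hA :=
    CompactOpens.ext (MultiEdge.smul_ends g⁻¹ e).symm
  rw [cochainEquivMeasure_apply, plecticMeasure.smul_apply, h1, cochainEquivMeasure_apply,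
    HC.smul_apply]

end CochainMeasure

end Plectic

/-! ### The theorem for completions of a number field -/

theorem lemma4p1 (F : Type*) [Field F] [NumberField F] (S : Finset (HeightOneSpectrum (𝓞 F))) :
    ∃ U : Plectic.MultiEdge (fun 𝔭 : S => 𝔭.1.adicCompletionIntegers F) →
        TopologicalSpace.CompactOpens (Plectic.P1S (fun 𝔭 : S => 𝔭.1.adicCompletion F)),
      (∀ e, (U e : Set (Plectic.P1S (fun 𝔭 : S => 𝔭.1.adicCompletion F))) = e.ends) ∧
      ∃ Φ : Plectic.HC (fun 𝔭 : S => 𝔭.1.adicCompletionIntegers F) ≃+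
          Plectic.plecticMeasure (fun 𝔭 : S => 𝔭.1.adicCompletion F),
        (∀ (g : Plectic.PGLS (fun 𝔭 : S => 𝔭.1.adicCompletion F))
          (c : Plectic.HC (fun 𝔭 : S => 𝔭.1.adicCompletionIntegers F)), Φ (g • c) = g • Φ c) ∧
        (∀ (c : Plectic.HC (fun 𝔭 : S => 𝔭.1.adicCompletionIntegers F))
          (e : Plectic.MultiEdge (fun 𝔭 : S => 𝔭.1.adicCompletionIntegers F)),
          (Φ c).1 (U e) = c.1 e) ∧
        (∀ (c : Plectic.HC (fun 𝔭 : S => 𝔭.1.adicCompletionIntegers F)),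
          ∀ μ ∈ Plectic.finAddMeasure (Plectic.P1S (fun 𝔭 : S => 𝔭.1.adicCompletion F)),
            (∀ e, μ (U e) = c.1 e) → μ = (Φ c).1) := by
  have hA : ∀ 𝔭 : S, IsOpen (𝔭.1.adicCompletionIntegers F : Set (𝔭.1.adicCompletion F)) :=
    fun 𝔭 => Plectic.isOpen_adicCompletionIntegers F 𝔭.1
  refine ⟨fun e => e.compactOpens hA, fun e => rfl, Plectic.cochainEquivMeasure hA,
    Plectic.cochainEquivMeasure_smul hA, Plectic.cochainEquivMeasure_apply hA, fun c μ hμ h => ?_⟩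
  -- Uniqueness holds among all finitely additive functions; vanishing on cylinders is not required
  -- of `μ`.
  refine Plectic.finAddMeasure_ext hA hμ (Plectic.cochainEquivMeasure hA c).2.1 fun e => ?_
  rw [h, Plectic.cochainEquivMeasure_apply]
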